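/- **Setting.** Let $\omega:[0,\infty)\to[1,\infty)$ be a weight, continuous on $[0,\infty)$ and differentiable on $(0,\infty)$, with $1/\omega\in L^1$, $\omega'/\omega\in L^\infty$ and $\ln\omega(y)/(1+y)\in L^\infty$. A *shear flow* is a function $U_s\in C^\infty([0,\infty),\mathbb R)$ with $U_s(0)=0$, $U_s(y)\to1$ as $y\to\infty$, $1-U_s\in L^1\cap L^2(\omega)$, and $U_s^{(j)}\in L^\infty$, $(1+y)U_s^{(j)}\in L^2(\omega)$ for $1\le j\le 3$, where $\|\psi\|_{L^2(\omega)}^2=\int_0^\infty|\psi|^2\omega\,dy$. Put $\Delta_s=\int_0^\infty(1-U_s)\,dy$. For $\nu>0$ the *linearized IBL system* around $U_s$, for unknowns $U(t,x,y),V(t,x,y),u_e(t,x)$ that are $2\pi$-periodic and mean-free in $x$, is $$\partial_tU+U_s\partial_xU+VU_s'-\partial_y^2U=\partial_tu_e+\partial_xu_e,\qquad \partial_xU+\partial_yV=0\qquad(y>0),$$ $$U|_{y=0}=V|_{y=0}=0,\qquad \lim_{y\to\infty}U=u_e,\qquad u_e=\sqrt\nu\,\mathcal{DN}\int_0^\infty(u_e-U)\,dy,$$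 where $\widehat{\mathcal{DN}f}(n)=|n|\hat f(n)$ for $n\in\mathbb Z$. For an integer $k>0$ and $\lambda\in\mathbb C$ with $\operatorname{Re}\lambda>0$, the system *displays a $(\lambda,k)$ instability* if there are $\mathcal U,\mathcal V\in C^\infty([0,\infty),\mathbb C)$ such that $(U,V,u_e)=e^{\lambda t}e^{ikx}(\mathcal U(y),\mathcal V(y),1)$ is a smooth solution. **Theorem.** Let $U_s$ be a shear flow that is monotone (non-decreasing) or, more generally, satisfies $\Delta_s\ne0$. For every $\epsilon>0$ there are positive constants $\bar\nu,K,S,\eta$ with the following property. For all $0<\nu\le\bar\nu$ and all integers $k$ with $|k|\ge K$ and $k\nu^{3/4}\ge S$, there is $\lambda\in\mathbb C$ such that the linearized IBL system displays a $(\lambda,k)$ instability and $$\operatorname{Re}\lambda\ge\eta\,\nu^{3/4}k^2 .$$ Moreover, $\lambda/k^2$ is a perturbation of a root of $f(\alpha)=\nu^{-1/2}$, where $f(\alpha)=-\frac{2i\Delta_s}{\alpha}+\alpha^{-1/2}$ (principal branch): there is $\alpha\in\mathbb C$ with $\operatorname{Re}\alpha>0$, $f(\alpha)=\nu^{-1/2}$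 and $|\lambda/k^2-\alpha|\le\epsilon\,\nu^{3/4}$. -/

import Mathlib

open Set Filter Topology MeasureTheory

open scoped ContDiff

noncomputable section

/-- Admissible weights on `[0, ∞)`: `w ≥ 1` and the three quantities `‖1/w‖_{L¹}`,
`‖w'/w‖_∞` and `‖ln w(y)/(1+y)‖_∞` are finite. -/
structure IsWeight (w : ℝ → ℝ) : Prop where
  continuousOn : ContinuousOn w (Ici 0)
  differentiableOn : DifferentiableOn ℝ w (Ioi 0)
  one_le : ∀ y, 0 ≤ y → 1 ≤ w y
  integrable_inv : IntegrableOn (fun y => 1 / w y) (Ioi 0)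
  logDeriv_bdd : ∃ C : ℝ, ∀ y, 0 < y → |deriv w y / w y| ≤ C
  log_bdd : ∃ C : ℝ, ∀ y, 0 ≤ y → |Real.log (w y) / (1 + y)| ≤ C

/-- Shear flows `U_s` on the half line `[0, ∞)` (values at negative `y` play no role): smooth up to
the boundary, `U_s(0) = 0`, `U_s(+∞) = 1`, `1 - U_s` integrable, `U_s^{(j)} ∈ L^∞` and
`(1+y) U_s^{(j)} ∈ L²(w)` for `j = 1, 2, 3`, and `1 - U_s ∈ L²(w)`.
No monotonicity is included. -/
structure IsShearFlow (w : ℝ → ℝ) (Us : ℝ → ℝ) : Prop where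
  smooth : ContDiffOn ℝ ∞ Us (Ici 0)
  zero : Us 0 = 0
  tendsto_one : Tendsto Us atTop (𝓝 1)
  integrable : IntegrableOn (fun y => 1 - Us y) (Ioi 0)
  deriv_bdd : ∀ j ∈ Finset.Icc 1 3, ∃ C : ℝ, ∀ y, 0 < y → |iteratedDeriv j Us y| ≤ C
  sq_integrable : IntegrableOn (fun y => (1 - Us y) ^ 2 * w y) (Ioi 0)
  deriv_sq_integrable : ∀ j ∈ Finset.Icc 1 3,
    IntegrableOn (fun y => ((1 + y) * iteratedDeriv j Us y) ^ 2 * w y) (Ioi 0)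

/-- The displacement thickness `Δ_s = ∫₀^∞ (1 - U_s) dy`. -/
def displacementThickness (Us : ℝ → ℝ) : ℝ := ∫ y in Ioi (0 : ℝ), (1 - Us y)

/-- `g = DN f` for the Dirichlet-to-Neumann operator acting on mean-free `2π`-periodic functions:
`ĝ(n) = |n| f̂(n)` for all `n ∈ ℤ`. It is stated as a graph between continuous functions, which are
determined by their Fourier coefficients. -/
structure IsDirichletToNeumann (f g : ℝ → ℂ) : Prop where
  continuous_left : Continuous f
  continuous_right : Continuous g
  periodic_left : Function.Periodic f (2 * Real.pi)
  periodic_right : Function.Periodic g (2 * Real.pi)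
  mean_zero_left : ∫ x in (0 : ℝ)..2 * Real.pi, f x = 0
  mean_zero_right : ∫ x in (0 : ℝ)..2 * Real.pi, g x = 0
  fourier : ∀ n : ℤ,
    fourierCoeffOn Real.two_pi_pos g n = ((|n| : ℤ) : ℂ) * fourierCoeffOn Real.two_pi_pos f n

/-- Smooth (complex-valued, `2π`-periodic in `x`, mean-free) solutions `(U, V, u_e)`, functions of
`(t, x, y)`, `(t, x, y)` and `(t, x)`, of the linearization of the interactive boundary layer
system around `U_s`:

`∂_t U + U_s ∂_x U + V U_s' - ∂_y² U = ∂_t u_e + ∂_x u_e`,  `∂_x U + ∂_y V = 0`,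

`U = V = 0` at `y = 0`,  `U → u_e` as `y → ∞`,  `u_e = √ν DN ∫₀^∞ (u_e - U) dy`.

The equations are imposed for `y > 0`. -/
structure IsLinearizedIBLSolution (ν : ℝ) (Us : ℝ → ℝ)
    (U V : ℝ → ℝ → ℝ → ℂ) (ue : ℝ → ℝ → ℂ) : Prop where
  smooth_U : ContDiffOn ℝ ∞ (fun p : ℝ × ℝ × ℝ => U p.1 p.2.1 p.2.2) (univ ×ˢ univ ×ˢ Ici 0)
  smooth_V : ContDiffOn ℝ ∞ (fun p : ℝ × ℝ × ℝ => V p.1 p.2.1 p.2.2) (univ ×ˢ univ ×ˢ Ici 0)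
  smooth_ue : ContDiff ℝ ∞ (fun p : ℝ × ℝ => ue p.1 p.2)
  periodic_U : ∀ t y, 0 ≤ y → Function.Periodic (fun x => U t x y) (2 * Real.pi)
  periodic_V : ∀ t y, 0 ≤ y → Function.Periodic (fun x => V t x y) (2 * Real.pi)
  periodic_ue : ∀ t, Function.Periodic (ue t) (2 * Real.pi)
  mean_zero_U : ∀ t y, 0 ≤ y → ∫ x in (0 : ℝ)..2 * Real.pi, U t x y = 0
  mean_zero_V : ∀ t y, 0 ≤ y → ∫ x in (0 : ℝ)..2 * Real.pi, V t x y = 0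
  mean_zero_ue : ∀ t, ∫ x in (0 : ℝ)..2 * Real.pi, ue t x = 0
  momentum : ∀ t x y, 0 < y →
    deriv (fun s => U s x y) t + (Us y : ℂ) * deriv (fun z => U t z y) x
        + V t x y * ((deriv Us y : ℝ) : ℂ) - iteratedDeriv 2 (fun z => U t x z) y
      = deriv (fun s => ue s x) t + deriv (fun z => ue t z) x
  incompressible : ∀ t x y, 0 < y →
    deriv (fun z => U t z y) x + deriv (fun z => V t x z) y = 0
  bc_U : ∀ t x, U t x 0 = 0
  bc_V : ∀ t x, V t x 0 = 0
  tendsto_ue : ∀ t x, Tendsto (fun y => U t x y) atTop (𝓝 (ue t x))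
  integrable : ∀ t x, IntegrableOn (fun y => ue t x - U t x y) (Ioi 0)
  coupling : ∀ t, ∃ g : ℝ → ℂ,
    IsDirichletToNeumann (fun x => ∫ y in Ioi (0 : ℝ), (ue t x - U t x y)) g ∧
      ∀ x, ue t x = (Real.sqrt ν : ℂ) * g x

/-- A linear system (given by its set of smooth solutions `(U, V, u_e)`) displays a `(lam, k)`
instability, where `k` is a positive integer and `Re lam > 0`: there are smooth profiles `mU`, `mV`
on `[0, ∞)` such that `e^{lam t} e^{i k x} (mU(y), mV(y), 1)` is a solution. -/
def DisplaysInstability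
    (IsSolution : (ℝ → ℝ → ℝ → ℂ) → (ℝ → ℝ → ℝ → ℂ) → (ℝ → ℝ → ℂ) → Prop)
    (lam : ℂ) (k : ℤ) : Prop :=
  0 < k ∧ 0 < lam.re ∧
    ∃ mU mV : ℝ → ℂ, ContDiffOn ℝ ∞ mU (Ici 0) ∧ ContDiffOn ℝ ∞ mV (Ici 0) ∧
      IsSolution
        (fun t x y => Complex.exp (lam * t) * Complex.exp (Complex.I * k * x) * mU y)
        (fun t x y => Complex.exp (lam * t) * Complex.exp (Complex.I * k * x) * mV y)
        (fun t x => Complex.exp (lam * t) * Complex.exp (Complex.I * k * x))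

/-- `f(α) = -2 i Δ / α + α^{-1/2}` (principal branch). -/
def reducedDispersion (Δ : ℝ) (α : ℂ) : ℂ :=
  -2 * Complex.I * Δ / α + α ^ (-(1 / 2) : ℂ)

end

open scoped BoundedContinuousFunction

noncomputable section

/-! ### Laplace transform of functions of at most linear growth -/

/-! Put U = φ', V = -ikφ, c = 1 - U_s and s = λ + ik. The system for the mode becomes U'' = s(U - 1)
- ik(cU - c'φ) with φ(0) = U(0) = 0 and √ν k θ = 1, where θ = ∫(1 - U). Write ν = δ⁴, so that θ =
1/(kδ²), and zoom in on a layer of thickness 1/m with m = kδ: φ(y) = y - θ - θψ(my), s = (mb)². The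
bracket cU - c'φ is the exact derivative of a forcing (`IsDefect.force`), so the equation integrates
once, to ψ'' = b²ψ + iJ with J this forcing in the variable Y = my. The conditions are ψ(0) = -1,
ψ'(0) = δ and decay at infinity. A bounded solution can meet only one of the conditions at 0 freely;
the other one is the dispersion relation b = δ + i∫e^{-bY}J(Y)dY.

J varies on the long scale m, and J(0) = -2Δ_s up to O(θ). If θ and 1/m are small compared with δ,
which is what kν^{3/4} ≥ S ensures, then J is nearly the constant -2Δ_s where e^{-bY} lives,
whatever ψ is, and the relation is a perturbation of b² = δb - 2iΔ_s, that is, of f((δb)²) =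
ν^{-1/2}. Its root b₀ (`exists_reduced_root`) has real part at least √|Δ_s|. As 2iΔ_s is imaginary,
Re b² is δ Re b up to the error, so errors must be small relative to δ; then Re λ = m² Re b² is of
order δ³k² = ν^{3/4}k².

`exists_profile` solves for b and ψ together by the contraction `exists_coupled_fixedPoint`;
`exists_stream_profile` returns to φ and U, and `displaysInstability_of_profile` to the full system.
Monotonicity serves only to give Δ_s ≠ 0. -/

theorem integrableOn_exp_neg_mul_one_add_pow {β : ℝ} (hβ : 0 < β) (n : ℕ) :
    IntegrableOn (fun a : ℝ => Real.exp (-(β * a)) * (1 + a) ^ n) (Ioi 0) := by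
  refine integrable_of_isBigO_exp_neg (b := β / 2) (by positivity) (by fun_prop) ?_
  have h1 : (fun a : ℝ => (1 + a) ^ n) =O[atTop] fun a => Real.exp (β / 2 * a) := by
    have h2 : (fun a : ℝ => 1 + a) =O[atTop] fun a : ℝ => a := by
      refine Asymptotics.IsBigO.of_bound 2 ?_
      filter_upwards [eventually_ge_atTop 1] with a ha
      rw [Real.norm_of_nonneg (by linarith), Real.norm_of_nonneg (by linarith)]; linarith
    exact (h2.pow n).trans (isLittleO_pow_exp_pos_mul_atTop n (by positivity)).isBigO
  have h3 := (Asymptotics.isBigO_refl (fun a : ℝ => Real.exp (-(β * a))) atTop).mul h1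
  refine h3.congr_right fun a => ?_
  rw [← Real.exp_add]; congr 1; ring

theorem norm_cexp_neg_mul_le {β : ℝ} {b : ℂ} (hb : β ≤ b.re) {a : ℝ} (ha : 0 ≤ a) :
    ‖Complex.exp (-(b * a))‖ ≤ Real.exp (-(β * a)) := by
  rw [Complex.norm_exp]
  simp only [Complex.neg_re, Complex.mul_re, Complex.ofReal_re, Complex.ofReal_im, mul_zero,
    sub_zero]
  gcongr

theorem norm_cexp_neg_mul_sub_le {β : ℝ} {b b' : ℂ} (hb : β ≤ b.re) (hb' : β ≤ b'.re) {a : ℝ}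
    (ha : 0 ≤ a) :
    ‖Complex.exp (-(b * a)) - Complex.exp (-(b' * a))‖ ≤
      Real.exp (-(β * a)) * a * ‖b - b'‖ := by
  refine Convex.norm_image_sub_le_of_norm_hasDerivWithin_le (s := {c : ℂ | β ≤ c.re})
    (f := fun z : ℂ => Complex.exp (-(z * a))) (f' := fun z => Complex.exp (-(z * a)) * (-a))
    (fun x _ => ?_) (fun x hx => ?_) (convex_halfSpace_re_ge β) hb' hb
  · have h : HasDerivAt (fun z : ℂ => -(z * a)) (-a : ℂ) x := by
      simpa using! ((hasDerivAt_id x).mul_const (a : ℂ)).neg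
    exact h.cexp.hasDerivWithinAt
  · rw [norm_mul, norm_neg, Complex.norm_real, Real.norm_of_nonneg ha]
    exact mul_le_mul_of_nonneg_right (norm_cexp_neg_mul_le hx ha) ha

/-- The Laplace transform `∫₀^∞ e^{-ba} f(a) da`. -/
def laplace (b : ℂ) (f : ℝ → ℂ) : ℂ := ∫ a in Ioi (0 : ℝ), Complex.exp (-(b * a)) * f a

/-- The moment `∫₀^∞ e^{-βa} (1+a)² da`, which controls Laplace transforms. -/
def laplaceMoment (β : ℝ) : ℝ := ∫ a in Ioi (0 : ℝ), Real.exp (-(β * a)) * (1 + a) ^ 2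

theorem laplaceMoment_nonneg (β : ℝ) : 0 ≤ laplaceMoment β :=
  setIntegral_nonneg measurableSet_Ioi fun a _ => by positivity

theorem integrableOn_laplace {b : ℂ} (hb : 0 < b.re) {f : ℝ → ℂ} (hf : Continuous f) {M : ℝ}
    (hM : ∀ a, 0 < a → ‖f a‖ ≤ M * (1 + a)) :
    IntegrableOn (fun a : ℝ => Complex.exp (-(b * a)) * f a) (Ioi 0) := by
  refine ((integrableOn_exp_neg_mul_one_add_pow hb 1).const_mul M).mono'
    (Continuous.aestronglyMeasurable (by fun_prop)) ?_
  filter_upwards [ae_restrict_mem measurableSet_Ioi] with a ha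
  rw [norm_mul]
  have h := mul_le_mul (norm_cexp_neg_mul_le (le_refl b.re) (le_of_lt ha)) (hM a ha)
    (norm_nonneg _) (by positivity)
  refine h.trans_eq (by ring)

theorem laplace_sub {b : ℂ} (hb : 0 < b.re) {f g : ℝ → ℂ} (hf : Continuous f) (hg : Continuous g)
    {M N : ℝ} (hM : ∀ a, 0 < a → ‖f a‖ ≤ M * (1 + a)) (hN : ∀ a, 0 < a → ‖g a‖ ≤ N * (1 + a)) :
    laplace b (fun a => f a - g a) = laplace b f - laplace b g := by
  unfold laplace
  rw [← integral_sub (integrableOn_laplace hb hf hM) (integrableOn_laplace hb hg hN)]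
  simp only [mul_sub]

theorem norm_laplace_le {β : ℝ} (hβ : 0 < β) {b : ℂ} (hb : β ≤ b.re) {f : ℝ → ℂ} {M : ℝ}
    (hM0 : 0 ≤ M) (hM : ∀ a, 0 < a → ‖f a‖ ≤ M * (1 + a)) :
    ‖laplace b f‖ ≤ M * laplaceMoment β := by
  unfold laplace laplaceMoment
  rw [← integral_const_mul]
  refine norm_integral_le_of_norm_le ((integrableOn_exp_neg_mul_one_add_pow hβ 2).const_mul M) ?_
  filter_upwards [ae_restrict_mem measurableSet_Ioi] with a ha
  have ha' : 0 < a := ha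
  rw [norm_mul]
  calc _ ≤ Real.exp (-(β * a)) * (M * (1 + a)) :=
        mul_le_mul (norm_cexp_neg_mul_le hb ha'.le) (hM a ha) (norm_nonneg _) (by positivity)
    _ ≤ Real.exp (-(β * a)) * (M * (1 + a) ^ 2) := by gcongr; nlinarith
    _ = _ := by ring

/-- Varying b costs a factor a, and f grows like 1 + a; the product a(1 + a) is the reason for the
second power in `laplaceMoment`. -/
theorem norm_laplace_sub_le {β : ℝ} (hβ : 0 < β) {b b' : ℂ} (hb : β ≤ b.re) (hb' : β ≤ b'.re)
    {f : ℝ → ℂ} (hf : Continuous f) {M : ℝ}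
    (hM0 : 0 ≤ M) (hM : ∀ a, 0 < a → ‖f a‖ ≤ M * (1 + a)) :
    ‖laplace b f - laplace b' f‖ ≤ M * laplaceMoment β * ‖b - b'‖ := by
  unfold laplace laplaceMoment
  rw [← integral_const_mul, ← integral_mul_const, ← integral_sub
    (integrableOn_laplace (hβ.trans_le hb) hf hM) (integrableOn_laplace (hβ.trans_le hb') hf hM)]
  refine norm_integral_le_of_norm_le
    (((integrableOn_exp_neg_mul_one_add_pow hβ 2).const_mul M).mul_const _) ?_
  filter_upwards [ae_restrict_mem measurableSet_Ioi] with a ha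
  have ha' : 0 < a := ha
  rw [← sub_mul, norm_mul]
  calc _ ≤ Real.exp (-(β * a)) * a * ‖b - b'‖ * (M * (1 + a)) :=
        mul_le_mul (norm_cexp_neg_mul_sub_le hb hb' ha'.le) (hM a ha) (norm_nonneg _)
          (by positivity)
    _ = M * (Real.exp (-(β * a)) * (a * (1 + a))) * ‖b - b'‖ := by ring
    _ ≤ M * (Real.exp (-(β * a)) * (1 + a) ^ 2) * ‖b - b'‖ := by gcongr; nlinarith

theorem laplace_const {b : ℂ} (hb : 0 < b.re) (z : ℂ) : laplace b (fun _ => z) = z / b := by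
  unfold laplace
  have h := integral_exp_mul_complex_Ioi (a := -b) (by simpa using hb) 0
  rw [integral_mul_const]
  simp only [neg_mul] at h
  rw [h]; simp [div_eq_mul_inv, mul_comm]

/-! ### Half-line integrals as functions of their endpoint -/

theorem setIntegral_Ioi_add_left {E : Type*} [NormedAddCommGroup E] [NormedSpace ℝ E]
    (f : ℝ → E) (y : ℝ) : ∫ a in Ioi (0 : ℝ), f (y + a) = ∫ z in Ioi y, f z := by
  have h := (measurePreserving_add_left (volume : Measure ℝ) y).setIntegral_preimage_emb
    (measurableEmbedding_addLeft y) f (Ioi y)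
  simpa using h

theorem integrableOn_Ioi_add_left {E : Type*} [NormedAddCommGroup E]
    (f : ℝ → E) (y : ℝ) :
    IntegrableOn (fun a => f (y + a)) (Ioi 0) ↔ IntegrableOn f (Ioi y) := by
  have h := (measurePreserving_add_left (volume : Measure ℝ) y).integrableOn_comp_preimage
    (measurableEmbedding_addLeft y) (f := f) (s := Ioi y)
  simpa [Function.comp_def] using h

theorem hasDerivAt_integral_Ioi {f : ℝ → ℂ} (hf : Continuous f) (hint : ∀ y, IntegrableOn f (Ioi y))
    (y : ℝ) : HasDerivAt (fun y => ∫ z in Ioi y, f z) (-f y) y := by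
  have h : (fun y => ∫ z in Ioi y, f z) =
      fun y => (∫ z in Ioi (0 : ℝ), f z) - ∫ z in (0 : ℝ)..y, f z := by
    funext y
    rw [← intervalIntegral.integral_Ioi_sub_Ioi' (hint 0) (hint y)]; ring
  rw [h]
  exact (intervalIntegral.integral_hasDerivAt_right (hf.intervalIntegrable _ _)
    (hf.stronglyMeasurableAtFilter _ _) hf.continuousAt).const_sub _

/-! ### The Helmholtz potential on the line -/

/-- `∫₀^∞ e^{-ba} J(Y+a) da`. -/
def forwardLaplace (b : ℂ) (J : ℝ → ℂ) (Y : ℝ) : ℂ := laplace b fun a => J (Y + a)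

/-- `∫₀^∞ e^{-ba} J(Y-a) da`. -/
def backwardLaplace (b : ℂ) (J : ℝ → ℂ) (Y : ℝ) : ℂ := laplace b fun a => J (Y - a)

/-- The bounded solution `(b² - ∂²)⁻¹ J` on the line. -/
def helmholtz (b : ℂ) (J : ℝ → ℂ) (Y : ℝ) : ℂ :=
  (forwardLaplace b J Y + backwardLaplace b J Y) / (2 * b)

theorem bound_mul_one_add {z : ℂ} {M a : ℝ} (hM : ‖z‖ ≤ M) (ha : 0 < a) : ‖z‖ ≤ M * (1 + a) := by
  nlinarith [norm_nonneg z]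

theorem backwardLaplace_eq (b : ℂ) (J : ℝ → ℂ) (Y : ℝ) :
    backwardLaplace b J Y = forwardLaplace b (fun y => J (-y)) (-Y) := by
  unfold backwardLaplace forwardLaplace
  congr 1; funext a; congr 1; ring

theorem integrableOn_cexp_neg_mul {b : ℂ} (hb : 0 < b.re) {J : ℝ → ℂ} (hJ : Continuous J) {M : ℝ}
    (hM : ∀ y, ‖J y‖ ≤ M) (Y : ℝ) :
    IntegrableOn (fun z : ℝ => Complex.exp (-(b * z)) * J z) (Ioi Y) := by
  rw [← integrableOn_Ioi_add_left (fun z : ℝ => Complex.exp (-(b * z)) * J z)]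
  have h := (integrableOn_laplace hb (f := fun a => J (Y + a)) (by fun_prop)
    (fun a ha => bound_mul_one_add (hM _) ha)).const_mul (Complex.exp (-(b * Y)))
  refine IntegrableOn.congr_fun h (fun a _ => ?_) measurableSet_Ioi
  rw [← mul_assoc, ← Complex.exp_add]; congr 2; push_cast; ring

theorem forwardLaplace_eq (b : ℂ) (J : ℝ → ℂ) (Y : ℝ) :
    forwardLaplace b J Y =
      Complex.exp (b * Y) * ∫ z in Ioi Y, Complex.exp (-(b * z)) * J z := by
  rw [← setIntegral_Ioi_add_left (fun z : ℝ => Complex.exp (-(b * z)) * J z), ← integral_const_mul]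
  unfold forwardLaplace laplace
  congr 1; funext a
  rw [← mul_assoc, ← Complex.exp_add]; congr 2; push_cast; ring

/-- J is only continuous, so the derivative must not fall on J. A translation gives e^{bY} ∫_Y^∞
e^{-bz} J(z) dz, a product of two differentiable factors. -/
theorem hasDerivAt_forwardLaplace {b : ℂ} (hb : 0 < b.re) {J : ℝ → ℂ} (hJ : Continuous J) {M : ℝ}
    (hM : ∀ y, ‖J y‖ ≤ M) (Y : ℝ) :
    HasDerivAt (forwardLaplace b J) (b * forwardLaplace b J Y - J Y) Y := by
  have h1 : HasDerivAt (fun y : ℝ => Complex.exp (b * y)) (Complex.exp (b * Y) * b) Y := by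
    have h : HasDerivAt (fun y : ℝ => b * (y : ℂ)) b Y := by
      simpa using! (Complex.ofRealCLM.hasDerivAt (x := Y)).const_mul b
    exact h.cexp
  have h2 := h1.mul (hasDerivAt_integral_Ioi (f := fun z : ℝ => Complex.exp (-(b * z)) * J z)
    (by fun_prop) (integrableOn_cexp_neg_mul hb hJ hM) Y)
  have h3 : forwardLaplace b J = fun Y : ℝ => Complex.exp (b * Y) *
      ∫ z in Ioi Y, Complex.exp (-(b * z)) * J z := funext fun Y => forwardLaplace_eq b J Y
  rw [h3]
  convert! h2 using 1
  have h4 : Complex.exp (b * Y) * (Complex.exp (-(b * Y)) * J Y) = J Y := by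
    rw [← mul_assoc, ← Complex.exp_add]; simp
  simp only [mul_neg, h4]; ring

theorem hasDerivAt_backwardLaplace {b : ℂ} (hb : 0 < b.re) {J : ℝ → ℂ} (hJ : Continuous J) {M : ℝ}
    (hM : ∀ y, ‖J y‖ ≤ M) (Y : ℝ) :
    HasDerivAt (backwardLaplace b J) (J Y - b * backwardLaplace b J Y) Y := by
  have h := hasDerivAt_forwardLaplace hb (J := fun y => J (-y)) (by fun_prop) (fun y => hM _) (-Y)
  have h2 := h.scomp Y (hasDerivAt_neg Y)
  rw [show backwardLaplace b J = fun Y => forwardLaplace b (fun y => J (-y)) (-Y) from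
    funext fun Y => backwardLaplace_eq b J Y]
  convert! h2 using 1
  simp

theorem hasDerivAt_helmholtz {b : ℂ} (hb : 0 < b.re) {J : ℝ → ℂ} (hJ : Continuous J) {M : ℝ}
    (hM : ∀ y, ‖J y‖ ≤ M) (Y : ℝ) :
    HasDerivAt (helmholtz b J) ((forwardLaplace b J Y - backwardLaplace b J Y) / 2) Y := by
  have hb0 : b ≠ 0 := by rintro rfl; simp at hb
  convert! ((hasDerivAt_forwardLaplace hb hJ hM Y).add
    (hasDerivAt_backwardLaplace hb hJ hM Y)).div_const (2 * b) using 1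
  field_simp; ring

theorem hasDerivAt_deriv_helmholtz {b : ℂ} (hb : 0 < b.re) {J : ℝ → ℂ} (hJ : Continuous J) {M : ℝ}
    (hM : ∀ y, ‖J y‖ ≤ M) (Y : ℝ) :
    HasDerivAt (fun Y => (forwardLaplace b J Y - backwardLaplace b J Y) / 2)
      (b ^ 2 * helmholtz b J Y - J Y) Y := by
  have hb0 : b ≠ 0 := by rintro rfl; simp at hb
  convert! ((hasDerivAt_forwardLaplace hb hJ hM Y).sub
    (hasDerivAt_backwardLaplace hb hJ hM Y)).div_const 2 using 1
  unfold helmholtz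
  field_simp; ring

theorem tendsto_laplace_zero {b : ℂ} (hb : 0 < b.re) {F : ℝ → ℝ → ℂ} {M : ℝ}
    (hF : ∀ Y, Continuous (F Y)) (hM : ∀ Y a, ‖F Y a‖ ≤ M)
    (h0 : ∀ a, Tendsto (fun Y => F Y a) atTop (𝓝 0)) :
    Tendsto (fun Y => laplace b (F Y)) atTop (𝓝 0) := by
  have h := tendsto_integral_filter_of_dominated_convergence (μ := volume.restrict (Ioi (0 : ℝ)))
    (l := atTop) (F := fun Y (a : ℝ) => Complex.exp (-(b * a)) * F Y a) (f := fun _ => 0)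
    (fun a => Real.exp (-(b.re * a)) * M)
    (Eventually.of_forall fun Y => Continuous.aestronglyMeasurable (by have := hF Y; fun_prop)) ?_ ?_ ?_
  · simpa [laplace] using h
  · refine Eventually.of_forall fun Y => ?_
    filter_upwards [ae_restrict_mem measurableSet_Ioi] with a ha
    rw [norm_mul]
    exact mul_le_mul (norm_cexp_neg_mul_le (le_refl b.re) (le_of_lt ha)) (hM _ _)
      (norm_nonneg _) (by positivity)
  · simpa using (integrableOn_exp_neg_mul_one_add_pow hb 0).mul_const M
  · refine Eventually.of_forall fun a => ?_
    simpa using (h0 a).const_mul (Complex.exp (-(b * a)))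

theorem tendsto_forwardLaplace_zero {b : ℂ} (hb : 0 < b.re) {J : ℝ → ℂ} (hJ : Continuous J) {M : ℝ}
    (hM : ∀ y, ‖J y‖ ≤ M) (h0 : Tendsto J atTop (𝓝 0)) :
    Tendsto (forwardLaplace b J) atTop (𝓝 0) :=
  tendsto_laplace_zero hb (F := fun Y a => J (Y + a)) (fun Y => by fun_prop) (fun _ _ => hM _)
    fun a => h0.comp (tendsto_atTop_add_const_right _ a tendsto_id)

theorem tendsto_backwardLaplace_zero {b : ℂ} (hb : 0 < b.re) {J : ℝ → ℂ} (hJ : Continuous J)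
    {M : ℝ} (hM : ∀ y, ‖J y‖ ≤ M) (h0 : Tendsto J atTop (𝓝 0)) :
    Tendsto (backwardLaplace b J) atTop (𝓝 0) :=
  tendsto_laplace_zero hb (F := fun Y a => J (Y - a)) (fun Y => by fun_prop) (fun _ _ => hM _)
    fun a => h0.comp (tendsto_atTop_add_const_right _ (-a) tendsto_id)

theorem norm_helmholtz_le {β : ℝ} (hβ : 0 < β) {b : ℂ} (hb : β ≤ b.re) {J : ℝ → ℂ} {M : ℝ}
    (hM : ∀ y, ‖J y‖ ≤ M) (Y : ℝ) : ‖helmholtz b J Y‖ ≤ M * laplaceMoment β / β := by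
  have hM0 : 0 ≤ M := (norm_nonneg _).trans (hM 0)
  have hbn : β ≤ ‖b‖ := hb.trans (Complex.re_le_norm b)
  have h1 : ‖forwardLaplace b J Y‖ ≤ M * laplaceMoment β :=
    norm_laplace_le hβ hb hM0 fun a ha => bound_mul_one_add (hM _) ha
  have h2 : ‖backwardLaplace b J Y‖ ≤ M * laplaceMoment β :=
    norm_laplace_le hβ hb hM0 fun a ha => bound_mul_one_add (hM _) ha
  have := laplaceMoment_nonneg β
  unfold helmholtz
  rw [norm_div, norm_mul, Complex.norm_ofNat]
  calc _ ≤ (M * laplaceMoment β + M * laplaceMoment β) / (2 * β) := by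
        gcongr; exact (norm_add_le _ _).trans (add_le_add h1 h2)
    _ = _ := by field_simp; ring

theorem norm_helmholtz_sub_le {β : ℝ} (hβ : 0 < β) {b b' : ℂ} (hb : β ≤ b.re) (hb' : β ≤ b'.re)
    {J : ℝ → ℂ} (hJ : Continuous J) {M : ℝ} (hM : ∀ y, ‖J y‖ ≤ M) (Y : ℝ) :
    ‖helmholtz b J Y - helmholtz b' J Y‖ ≤
      M * laplaceMoment β * (1 / β + 1 / β ^ 2) * ‖b - b'‖ := by
  have hM0 : 0 ≤ M := (norm_nonneg _).trans (hM 0)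
  have hbn : β ≤ ‖b‖ := hb.trans (Complex.re_le_norm b)
  have hbn' : β ≤ ‖b'‖ := hb'.trans (Complex.re_le_norm b')
  have hb0 : b ≠ 0 := by rintro rfl; simp at hb; linarith
  have hb0' : b' ≠ 0 := by rintro rfl; simp at hb'; linarith
  have h1 : ‖forwardLaplace b J Y - forwardLaplace b' J Y‖ ≤ M * laplaceMoment β * ‖b - b'‖ :=
    norm_laplace_sub_le hβ hb hb' (by fun_prop) hM0 fun a ha => bound_mul_one_add (hM _) ha
  have h2 : ‖backwardLaplace b J Y - backwardLaplace b' J Y‖ ≤ M * laplaceMoment β * ‖b - b'‖ :=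
    norm_laplace_sub_le hβ hb hb' (by fun_prop) hM0 fun a ha => bound_mul_one_add (hM _) ha
  have h3 := norm_helmholtz_le hβ hb' hM Y
  have hI := laplaceMoment_nonneg β
  -- Separates the variation of the two transforms from that of the prefactor 1/(2b).
  have key : helmholtz b J Y - helmholtz b' J Y =
      ((forwardLaplace b J Y - forwardLaplace b' J Y) +
        (backwardLaplace b J Y - backwardLaplace b' J Y)) / (2 * b)
      - helmholtz b' J Y * ((b - b') / b) := by
    unfold helmholtz; field_simp; ring
  rw [key]
  refine (norm_sub_le _ _).trans ?_
  rw [norm_div, norm_mul, norm_mul, norm_div, Complex.norm_ofNat]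
  calc _ ≤ (M * laplaceMoment β * ‖b - b'‖ + M * laplaceMoment β * ‖b - b'‖) / (2 * β)
        + M * laplaceMoment β / β * (‖b - b'‖ / β) := by
        gcongr; exact (norm_add_le _ _).trans (add_le_add h1 h2)
    _ = _ := by field_simp; ring

/-- `helmholtz` as a map on bounded continuous functions. -/
def helmholtzBCF (b : ℂ) (hb : 0 < b.re) (J : ℝ →ᵇ ℂ) : ℝ →ᵇ ℂ :=
  BoundedContinuousFunction.ofNormedAddCommGroup (helmholtz b J)
    (continuous_iff_continuousAt.2 fun Y =>
      (hasDerivAt_helmholtz hb J.continuous J.norm_coe_le_norm Y).continuousAt)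
    _ (norm_helmholtz_le hb le_rfl J.norm_coe_le_norm)

theorem helmholtz_sub {b : ℂ} (hb : 0 < b.re) (J K : ℝ →ᵇ ℂ) (Y : ℝ) :
    helmholtz b (J - K : ℝ →ᵇ ℂ) Y = helmholtz b J Y - helmholtz b K Y := by
  have h1 : forwardLaplace b (J - K : ℝ →ᵇ ℂ) Y =
      forwardLaplace b J Y - forwardLaplace b K Y :=
    laplace_sub hb (f := fun a => J (Y + a)) (g := fun a => K (Y + a)) (by fun_prop) (by fun_prop)
      (fun a ha => bound_mul_one_add (J.norm_coe_le_norm _) ha)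
      (fun a ha => bound_mul_one_add (K.norm_coe_le_norm _) ha)
  have h2 : backwardLaplace b (J - K : ℝ →ᵇ ℂ) Y =
      backwardLaplace b J Y - backwardLaplace b K Y :=
    laplace_sub hb (f := fun a => J (Y - a)) (g := fun a => K (Y - a)) (by fun_prop) (by fun_prop)
      (fun a ha => bound_mul_one_add (J.norm_coe_le_norm _) ha)
      (fun a ha => bound_mul_one_add (K.norm_coe_le_norm _) ha)
  unfold helmholtz
  rw [h1, h2]; ring

/-! ### A coupled fixed point -/

/-- `Φ₂` is Lipschitz in b with a constant C that need not be small, so (`Φ₁`, `Φ₂`) itself may fail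
to contract. Feeding the updated b into `Φ₂` multiplies C by the small constant of `Φ₁`: the second
component then has constant 2Cκ + κ. Both maps have the same fixed points. -/
theorem exists_coupled_fixedPoint {E : Type*} [NormedAddCommGroup E] [CompleteSpace E] {b₀ : ℂ}
    {r M κ C : ℝ} (hr : 0 ≤ r) (hM : 0 ≤ M) (hκ0 : 0 ≤ κ) (hC : 0 ≤ C) (Φ₁ : ℂ → E → ℂ)
    (Φ₂ : ℂ → E → E)
    (h₁ : ∀ b ψ, ‖b - b₀‖ ≤ r → ‖ψ‖ ≤ M → ‖Φ₁ b ψ - b₀‖ ≤ r)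
    (h₂ : ∀ b ψ, ‖b - b₀‖ ≤ r → ‖ψ‖ ≤ M → ‖Φ₂ b ψ‖ ≤ M)
    (l₁ : ∀ b ψ b' ψ', ‖b - b₀‖ ≤ r → ‖ψ‖ ≤ M → ‖b' - b₀‖ ≤ r → ‖ψ'‖ ≤ M →
      ‖Φ₁ b ψ - Φ₁ b' ψ'‖ ≤ κ * (‖b - b'‖ + ‖ψ - ψ'‖))
    (l₂ : ∀ b ψ b' ψ', ‖b - b₀‖ ≤ r → ‖ψ‖ ≤ M → ‖b' - b₀‖ ≤ r → ‖ψ'‖ ≤ M →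
      ‖Φ₂ b ψ - Φ₂ b' ψ'‖ ≤ C * ‖b - b'‖ + κ * ‖ψ - ψ'‖)
    (hκ : 2 * κ ≤ 1 / 2) (hCκ : 2 * C * κ + κ ≤ 1 / 2) :
    ∃ b ψ, ‖b - b₀‖ ≤ r ∧ ‖ψ‖ ≤ M ∧ Φ₁ b ψ = b ∧ Φ₂ b ψ = ψ := by
  let F : ℂ × E → ℂ × E := fun p => (Φ₁ p.1 p.2, Φ₂ (Φ₁ p.1 p.2) p.2)
  let s : Set (ℂ × E) := Metric.closedBall b₀ r ×ˢ Metric.closedBall 0 M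
  have hs : IsComplete s :=
    (Metric.isClosed_closedBall.prod Metric.isClosed_closedBall).isComplete
  have mem (p : ℂ × E) : p ∈ s ↔ ‖p.1 - b₀‖ ≤ r ∧ ‖p.2‖ ≤ M := by
    simp only [s, mem_prod, mem_closedBall_iff_norm, sub_zero]
  have hmaps : MapsTo F s s := by
    intro p hp
    rw [mem] at hp ⊢
    exact ⟨h₁ _ _ hp.1 hp.2, h₂ _ _ (h₁ _ _ hp.1 hp.2) hp.2⟩
  have hlip : ContractingWith (1 / 2) (hmaps.restrict F s s) := by
    refine ⟨by rw [← NNReal.coe_lt_coe]; norm_num, LipschitzWith.of_dist_le_mul ?_⟩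
    rintro ⟨p, hp⟩ ⟨q, hq⟩
    have hp' := (mem p).1 hp
    have hq' := (mem q).1 hq
    have e1 : ‖p.1 - q.1‖ ≤ dist p q := by
      rw [← dist_eq_norm]; exact le_max_left _ _
    have e2 : ‖p.2 - q.2‖ ≤ dist p q := by
      rw [← dist_eq_norm]; exact le_max_right _ _
    have d0 : 0 ≤ dist p q := dist_nonneg
    have f1 := l₁ p.1 p.2 q.1 q.2 hp'.1 hp'.2 hq'.1 hq'.2
    have f1' : ‖Φ₁ p.1 p.2 - Φ₁ q.1 q.2‖ ≤ 2 * κ * dist p q := by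
      refine f1.trans ?_
      nlinarith [mul_le_mul_of_nonneg_left (add_le_add e1 e2) hκ0]
    have f2 := l₂ (Φ₁ p.1 p.2) p.2 (Φ₁ q.1 q.2) q.2 (h₁ _ _ hp'.1 hp'.2) hp'.2
      (h₁ _ _ hq'.1 hq'.2) hq'.2
    change dist (F p) (F q) ≤ ((1 / 2 : NNReal) : ℝ) * dist p q
    have half : ((1 / 2 : NNReal) : ℝ) = 1 / 2 := by norm_num
    rw [half]
    refine max_le ?_ ?_
    · rw [dist_eq_norm]
      exact f1'.trans (mul_le_mul_of_nonneg_right hκ d0)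
    · rw [dist_eq_norm]
      refine f2.trans ?_
      calc _ ≤ C * (2 * κ * dist p q) + κ * dist p q := by gcongr
        _ = (2 * C * κ + κ) * dist p q := by ring
        _ ≤ _ := mul_le_mul_of_nonneg_right hCκ d0
  obtain ⟨y, hy, hfix, -⟩ := hlip.exists_fixedPoint' hs hmaps (x := (b₀, 0))
    ((mem _).2 ⟨by simpa using hr, by simpa using hM⟩) (edist_ne_top _ _)
  have hy' := (mem y).1 hy
  have g1 : Φ₁ y.1 y.2 = y.1 := congrArg Prod.fst hfix
  have g2 : Φ₂ (Φ₁ y.1 y.2) y.2 = y.2 := congrArg Prod.snd hfix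
  rw [g1] at g2
  exact ⟨y.1, y.2, hy'.1, hy'.2, g1, g2⟩

/-! ### Tail integrals -/

/-- The even tail integral `∫_{|y|}^∞ f`. -/
def tailIntegral (f : ℝ → ℂ) (y : ℝ) : ℂ := ∫ z in Ioi |y|, f z

theorem tailIntegral_eq {f : ℝ → ℂ} (hi : IntegrableOn f (Ioi 0)) (y : ℝ) :
    tailIntegral f y = (∫ z in Ioi (0 : ℝ), f z) - ∫ z in (0 : ℝ)..|y|, f z := by
  unfold tailIntegral
  rw [← intervalIntegral.integral_Ioi_sub_Ioi hi (abs_nonneg y)]; ring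

theorem continuous_tailIntegral {f : ℝ → ℂ} (hf : Continuous f) (hi : IntegrableOn f (Ioi 0)) :
    Continuous (tailIntegral f) := by
  rw [show tailIntegral f = _ from funext (tailIntegral_eq hi)]
  exact continuous_const.sub
    ((intervalIntegral.continuous_primitive (fun a b => hf.intervalIntegrable a b) 0).comp
      continuous_abs)

theorem norm_tailIntegral_le {f : ℝ → ℂ} {g : ℝ → ℝ} (hg : IntegrableOn g (Ioi 0))
    (h : ∀ y, 0 < y → ‖f y‖ ≤ g y) (y : ℝ) : ‖tailIntegral f y‖ ≤ ∫ z in Ioi |y|, g z := by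
  refine norm_integral_le_of_norm_le (hg.mono_set (Ioi_subset_Ioi (abs_nonneg y))) ?_
  filter_upwards [ae_restrict_mem measurableSet_Ioi] with a ha
  exact h a ((abs_nonneg y).trans_lt ha)

theorem setIntegral_Ioi_abs_le {g : ℝ → ℝ} (hg : IntegrableOn g (Ioi 0))
    (h : ∀ y, 0 < y → 0 ≤ g y) (y : ℝ) : ∫ z in Ioi |y|, g z ≤ ∫ z in Ioi (0 : ℝ), g z := by
  refine setIntegral_mono_set hg ?_ (Ioi_subset_Ioi (abs_nonneg y)).eventuallyLE
  filter_upwards [ae_restrict_mem measurableSet_Ioi] with a ha using h a ha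

theorem tendsto_tailIntegral {f : ℝ → ℂ} (hi : IntegrableOn f (Ioi 0)) :
    Tendsto (tailIntegral f) atTop (𝓝 0) := by
  have h := (intervalIntegral_tendsto_integral_Ioi 0 hi tendsto_abs_atTop_atTop).const_sub
    (∫ z in Ioi (0 : ℝ), f z)
  rw [sub_self] at h
  exact h.congr fun y => (tailIntegral_eq hi y).symm

theorem hasDerivWithinAt_tailIntegral {f : ℝ → ℂ} (hf : Continuous f)
    (hi : IntegrableOn f (Ioi 0)) {y : ℝ} (hy : 0 ≤ y) :
    HasDerivWithinAt (tailIntegral f) (-f y) (Ici 0) y := by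
  have h : HasDerivAt (fun y => (∫ z in Ioi (0 : ℝ), f z) - ∫ z in (0 : ℝ)..y, f z) (-f y) y :=
    (intervalIntegral.integral_hasDerivAt_right (hf.intervalIntegrable _ _)
      (hf.stronglyMeasurableAtFilter _ _) hf.continuousAt).const_sub _
  refine h.hasDerivWithinAt.congr (fun z hz => ?_) ?_
  · rw [tailIntegral_eq hi, abs_of_nonneg hz]
  · rw [tailIntegral_eq hi, abs_of_nonneg hy]

/-! ### The forcing generated by a velocity defect -/

/-- `c` is (the even extension of) a velocity defect `1 - U_s` and `c₁` of its derivative. -/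
structure IsDefect (c c₁ : ℝ → ℝ) : Prop where
  continuous : Continuous c
  continuous_deriv : Continuous c₁
  even : ∀ y, c |y| = c y
  hasDeriv : ∀ y, 0 ≤ y → HasDerivWithinAt c (c₁ y) (Ici 0) y
  integrable : IntegrableOn c (Ioi 0)
  integrable_deriv : IntegrableOn c₁ (Ioi 0)
  integrable_mul_deriv : IntegrableOn (fun y => y * c₁ y) (Ioi 0)
  tendsto : Tendsto c atTop (𝓝 0)

namespace IsDefect

variable {c c₁ : ℝ → ℝ}

theorem tail_deriv (h : IsDefect c c₁) (y : ℝ) : ∫ z in Ioi |y|, c₁ z = -c y := by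
  rw [integral_Ioi_of_hasDerivAt_of_tendsto (f := c) (m := 0) h.continuous.continuousWithinAt
    (fun x hx => ?_) (h.integrable_deriv.mono_set (Ioi_subset_Ioi (abs_nonneg y))) h.tendsto,
    h.even, zero_sub]
  have hx0 : 0 < x := (abs_nonneg y).trans_lt hx
  exact (h.hasDeriv x hx0.le).hasDerivAt (Ici_mem_nhds hx0)

theorem abs_le_tail (h : IsDefect c c₁) (y : ℝ) : |c y| ≤ ∫ z in Ioi |y|, |c₁ z| := by
  rw [← abs_neg, ← h.tail_deriv y]
  exact norm_integral_le_integral_norm c₁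

/-- A bound of the defect. -/
def bound (c₁ : ℝ → ℝ) : ℝ := ∫ z in Ioi (0 : ℝ), |c₁ z|

theorem bound_nonneg (c₁ : ℝ → ℝ) : 0 ≤ bound c₁ :=
  setIntegral_nonneg measurableSet_Ioi fun _ _ => abs_nonneg _

theorem abs_le (h : IsDefect c c₁) (y : ℝ) : |c y| ≤ bound c₁ :=
  (h.abs_le_tail y).trans
    (setIntegral_Ioi_abs_le h.integrable_deriv.norm (fun _ _ => abs_nonneg _) y)

/-- For z > |y| the factor |y| is at most z and can be moved under the integral. Integrability of
yc' thus makes yc bounded and vanishing at infinity. -/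
theorem abs_mul_le_tail (h : IsDefect c c₁) (y : ℝ) :
    |y| * |c y| ≤ ∫ z in Ioi |y|, |z * c₁ z| := by
  refine (mul_le_mul_of_nonneg_left (h.abs_le_tail y) (abs_nonneg y)).trans ?_
  rw [← integral_const_mul]
  refine setIntegral_mono_on
    ((IntegrableOn.mono_set h.integrable_deriv (Ioi_subset_Ioi (abs_nonneg y))).abs.const_mul _)
    (IntegrableOn.mono_set h.integrable_mul_deriv (Ioi_subset_Ioi (abs_nonneg y))).abs
    measurableSet_Ioi fun z hz => ?_
  rw [abs_mul]
  have hz' : |y| < z := hz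
  exact mul_le_mul_of_nonneg_right (hz'.le.trans (le_abs_self z)) (abs_nonneg _)

/-- The part `-y c - 2 ∫_y^∞ c` of the forcing independent of the unknown. -/
def source (c : ℝ → ℝ) (y : ℝ) : ℂ := -((|y| * c y : ℝ) : ℂ) - 2 * tailIntegral (fun z => (c z : ℂ)) y

/-- The linear part `c χ + 2 ∫_y^∞ c' χ` of the forcing. -/
def coupling (c c₁ : ℝ → ℝ) (χ : ℝ → ℂ) (y : ℝ) : ℂ :=
  (c y : ℂ) * χ |y| + 2 * tailIntegral (fun z => (c₁ z : ℂ) * χ z) y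

/-- A bound of the source. -/
def sourceBound (c c₁ : ℝ → ℝ) : ℝ :=
  (∫ z in Ioi (0 : ℝ), |z * c₁ z|) + 2 * ∫ z in Ioi (0 : ℝ), |c z|

theorem integrableOn_ofReal {f : ℝ → ℝ} (hf : IntegrableOn f (Ioi 0)) :
    IntegrableOn (fun z => (f z : ℂ)) (Ioi 0) := Integrable.ofReal hf

theorem integrableOn_deriv_mul (h : IsDefect c c₁) (χ : ℝ →ᵇ ℂ) :
    IntegrableOn (fun z => (c₁ z : ℂ) * χ z) (Ioi 0) :=
  Integrable.mul_bdd (c := ‖χ‖) (integrableOn_ofReal h.integrable_deriv)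
    χ.continuous.aestronglyMeasurable (Eventually.of_forall χ.norm_coe_le_norm)

theorem continuous_source (h : IsDefect c c₁) : Continuous (source c) := by
  have h1 := continuous_tailIntegral (f := fun z => (c z : ℂ))
    (Complex.continuous_ofReal.comp h.continuous) (integrableOn_ofReal h.integrable)
  have h2 := h.continuous
  unfold source
  fun_prop

theorem continuous_coupling (h : IsDefect c c₁) (χ : ℝ →ᵇ ℂ) : Continuous (coupling c c₁ χ) := by
  have h3 := h.continuous_deriv
  have h1 := continuous_tailIntegral (f := fun z => (c₁ z : ℂ) * χ z)
    (by fun_prop) (h.integrableOn_deriv_mul χ)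
  have h2 := h.continuous
  unfold coupling
  fun_prop

theorem norm_source_le (h : IsDefect c c₁) (y : ℝ) : ‖source c y‖ ≤ sourceBound c c₁ := by
  have h1 : ‖tailIntegral (fun z => (c z : ℂ)) y‖ ≤ ∫ z in Ioi (0 : ℝ), |c z| :=
    (norm_tailIntegral_le h.integrable.norm (fun y _ => by simp) y).trans
      (setIntegral_Ioi_abs_le h.integrable.norm (fun _ _ => abs_nonneg _) y)
  have h2 := (h.abs_mul_le_tail y).trans
      (setIntegral_Ioi_abs_le h.integrable_mul_deriv.norm (fun _ _ => abs_nonneg _) y)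
  unfold source sourceBound
  refine (norm_sub_le _ _).trans (add_le_add ?_ ?_)
  · rw [norm_neg, Complex.norm_real, Real.norm_eq_abs, abs_mul, abs_abs]; exact h2
  · rw [norm_mul, Complex.norm_ofNat]; gcongr

theorem norm_coupling_le (h : IsDefect c c₁) (χ : ℝ →ᵇ ℂ) (y : ℝ) :
    ‖coupling c c₁ χ y‖ ≤ 3 * bound c₁ * ‖χ‖ := by
  have h1 : ‖tailIntegral (fun z => (c₁ z : ℂ) * χ z) y‖ ≤ bound c₁ * ‖χ‖ := by
    have := norm_tailIntegral_le (f := fun z => (c₁ z : ℂ) * χ z) (g := fun z => |c₁ z| * ‖χ‖)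
      (h.integrable_deriv.norm.mul_const _) (fun y _ => by
        rw [norm_mul, Complex.norm_real, Real.norm_eq_abs]
        gcongr; exact χ.norm_coe_le_norm y) y
    refine this.trans ((setIntegral_Ioi_abs_le (h.integrable_deriv.norm.mul_const _)
      (fun _ _ => by positivity) y).trans_eq ?_)
    rw [integral_mul_const]; rfl
  have h2 : ‖(c y : ℂ) * χ |y|‖ ≤ bound c₁ * ‖χ‖ := by
    rw [norm_mul, Complex.norm_real, Real.norm_eq_abs]
    exact mul_le_mul (h.abs_le y) (χ.norm_coe_le_norm _) (norm_nonneg _) (bound_nonneg _)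
  unfold coupling
  refine (norm_add_le _ _).trans ?_
  rw [norm_mul 2, Complex.norm_ofNat]
  linarith

theorem coupling_sub (h : IsDefect c c₁) (χ χ' : ℝ →ᵇ ℂ) (y : ℝ) :
    coupling c c₁ (χ - χ' : ℝ →ᵇ ℂ) y = coupling c c₁ χ y - coupling c c₁ χ' y := by
  have : tailIntegral (fun z => (c₁ z : ℂ) * (χ - χ' : ℝ →ᵇ ℂ) z) y =
      tailIntegral (fun z => (c₁ z : ℂ) * χ z) y - tailIntegral (fun z => (c₁ z : ℂ) * χ' z) y := by
    unfold tailIntegral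
    rw [← integral_sub ((h.integrableOn_deriv_mul χ).mono_set (Ioi_subset_Ioi (abs_nonneg y)))
      ((h.integrableOn_deriv_mul χ').mono_set (Ioi_subset_Ioi (abs_nonneg y)))]
    simp only [BoundedContinuousFunction.coe_sub, Pi.sub_apply, mul_sub]
  unfold coupling
  rw [this, BoundedContinuousFunction.coe_sub, Pi.sub_apply]; ring

theorem source_zero (c : ℝ → ℝ) :
    source c 0 = -2 * ((∫ z in Ioi (0 : ℝ), c z : ℝ) : ℂ) := by
  unfold source tailIntegral
  rw [integral_complex_ofReal]; simp

/-- Only the boundedness of c is used. At the point a/m this bound becomes the 1/m part of the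
deviation of the forcing from a constant. -/
theorem norm_source_sub_le (h : IsDefect c c₁) (y : ℝ) :
    ‖source c y - source c 0‖ ≤ 3 * bound c₁ * |y| := by
  have hi := integrableOn_ofReal h.integrable
  have e : source c y - source c 0 =
      -((|y| * c y : ℝ) : ℂ) + 2 * ∫ z in (0 : ℝ)..|y|, (c z : ℂ) := by
    unfold source
    rw [tailIntegral_eq hi, tailIntegral_eq hi]; simp; ring
  have h1 : ‖∫ z in (0 : ℝ)..|y|, (c z : ℂ)‖ ≤ bound c₁ * |(|y|) - 0| :=
    intervalIntegral.norm_integral_le_of_norm_le_const fun z _ => by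
      rw [Complex.norm_real]; exact h.abs_le z
  rw [sub_zero, abs_abs] at h1
  rw [e]
  refine (norm_add_le _ _).trans ?_
  rw [norm_neg, Complex.norm_real, Real.norm_eq_abs, abs_mul, abs_abs, norm_mul, Complex.norm_ofNat]
  have := mul_le_mul_of_nonneg_left (h.abs_le y) (abs_nonneg y)
  linarith

/-- The forcing `-y c - 2 ∫_y^∞ c + θ c - c χ - 2 ∫_y^∞ c' χ`. -/
def force (h : IsDefect c c₁) (θ : ℝ) (χ : ℝ →ᵇ ℂ) : ℝ →ᵇ ℂ :=
  BoundedContinuousFunction.ofNormedAddCommGroup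
    (fun y => source c y + ((θ * c y : ℝ) : ℂ) - coupling c c₁ χ y)
    (by
      have h1 := h.continuous_source
      have h2 := h.continuous_coupling χ
      have h3 := h.continuous
      fun_prop)
    (sourceBound c c₁ + |θ| * bound c₁ + 3 * bound c₁ * ‖χ‖) (fun y => by
      refine (norm_sub_le _ _).trans (add_le_add ((norm_add_le _ _).trans (add_le_add ?_ ?_)) ?_)
      · exact h.norm_source_le y
      · rw [Complex.norm_real, Real.norm_eq_abs, abs_mul]
        gcongr; exact h.abs_le y
      · exact h.norm_coupling_le χ y)

theorem force_apply (h : IsDefect c c₁) (θ : ℝ) (χ : ℝ →ᵇ ℂ) (y : ℝ) :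
    h.force θ χ y = source c y + ((θ * c y : ℝ) : ℂ) - coupling c c₁ χ y := rfl

theorem norm_force_le (h : IsDefect c c₁) (θ : ℝ) (χ : ℝ →ᵇ ℂ) :
    ‖h.force θ χ‖ ≤ sourceBound c c₁ + |θ| * bound c₁ + 3 * bound c₁ * ‖χ‖ := by
  have h1 : 0 ≤ sourceBound c c₁ := (norm_nonneg _).trans (h.norm_source_le 0)
  have := bound_nonneg c₁
  exact BoundedContinuousFunction.norm_ofNormedAddCommGroup_le _ (by positivity) _

theorem norm_force_sub_le (h : IsDefect c c₁) (θ : ℝ) (χ χ' : ℝ →ᵇ ℂ) :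
    ‖h.force θ χ - h.force θ χ'‖ ≤ 3 * bound c₁ * ‖χ - χ'‖ := by
  have := bound_nonneg c₁
  refine (BoundedContinuousFunction.norm_le (by positivity)).2 fun y => ?_
  have e : (h.force θ χ - h.force θ χ') y = -coupling c c₁ (χ - χ' : ℝ →ᵇ ℂ) y := by
    rw [h.coupling_sub, BoundedContinuousFunction.coe_sub, Pi.sub_apply, force_apply, force_apply]
    ring
  rw [e, norm_neg]
  exact h.norm_coupling_le _ y

theorem norm_force_sub_source_le (h : IsDefect c c₁) (θ : ℝ) (χ : ℝ →ᵇ ℂ) (y : ℝ) :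
    ‖h.force θ χ y - source c 0‖ ≤ 3 * bound c₁ * |y| + (|θ| * bound c₁ + 3 * bound c₁ * ‖χ‖) := by
  have e : h.force θ χ y - source c 0 =
      (source c y - source c 0) + (((θ * c y : ℝ) : ℂ) - coupling c c₁ χ y) := by
    rw [force_apply]; ring
  rw [e]
  refine (norm_add_le _ _).trans (add_le_add (h.norm_source_sub_le y)
    ((norm_sub_le _ _).trans (add_le_add ?_ (h.norm_coupling_le χ y))))
  rw [Complex.norm_real, Real.norm_eq_abs, abs_mul]
  gcongr; exact h.abs_le y

theorem force_even (h : IsDefect c c₁) (θ : ℝ) (χ : ℝ →ᵇ ℂ) (y : ℝ) :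
    h.force θ χ (-y) = h.force θ χ y := by
  have hc : c (-y) = c y := by rw [← h.even, abs_neg, h.even]
  simp only [force_apply, source, coupling, tailIntegral, abs_neg, hc]

theorem tendsto_force (h : IsDefect c c₁) (θ : ℝ) (χ : ℝ →ᵇ ℂ) :
    Tendsto (h.force θ χ) atTop (𝓝 0) := by
  have t1 : Tendsto (fun y => ((|y| * c y : ℝ) : ℂ)) atTop (𝓝 0) := by
    rw [tendsto_zero_iff_norm_tendsto_zero]
    have h1 := (tendsto_tailIntegral (integrableOn_ofReal h.integrable_mul_deriv.norm)).norm
    rw [norm_zero] at h1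
    refine squeeze_zero (fun _ => norm_nonneg _) (fun y => ?_) h1
    rw [Complex.norm_real, Real.norm_eq_abs, abs_mul, abs_abs]
    refine (h.abs_mul_le_tail y).trans ?_
    unfold tailIntegral
    rw [integral_complex_ofReal, Complex.norm_real]
    exact le_abs_self _
  have t2 := tendsto_tailIntegral (integrableOn_ofReal h.integrable)
  have t0 : Tendsto (fun y => (c y : ℂ)) atTop (𝓝 0) := by
    simpa [Function.comp_def] using (Complex.continuous_ofReal.tendsto 0).comp h.tendsto
  have t3 : Tendsto (fun y => ((θ * c y : ℝ) : ℂ)) atTop (𝓝 0) := by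
    simpa using t0.const_mul (θ : ℂ)
  have t4 : Tendsto (fun y => (c y : ℂ) * χ |y|) atTop (𝓝 0) := by
    rw [tendsto_zero_iff_norm_tendsto_zero]
    have t0' := t0.norm.mul_const ‖χ‖
    rw [norm_zero, zero_mul] at t0'
    refine squeeze_zero (fun _ => norm_nonneg _) (fun y => ?_) t0'
    rw [norm_mul]
    exact mul_le_mul_of_nonneg_left (χ.norm_coe_le_norm |y|) (norm_nonneg (c y : ℂ))
  have t5 := tendsto_tailIntegral (h.integrableOn_deriv_mul χ)
  have := ((t1.neg.sub (t2.const_mul 2)).add t3).sub (t4.add (t5.const_mul 2))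
  simp only [neg_zero, mul_zero, sub_zero, add_zero] at this
  exact this

/-- The coefficients 2 in `force` are chosen for this: the tails turn -(yc)' into c - yc' and -(cχ)'
into c'χ - cχ'. For χ = y - θ - φ the result is cφ' - c'φ, the bracket of the momentum equation. The
derivative is one-sided because the even extension may have a corner at 0. -/
theorem hasDerivWithinAt_force (h : IsDefect c c₁) (θ : ℝ) (χ : ℝ →ᵇ ℂ) {χ₁ : ℂ} {y : ℝ}
    (hy : 0 ≤ y) (hχ : HasDerivWithinAt χ χ₁ (Ici 0) y) :
    HasDerivWithinAt (h.force θ χ)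
      ((c y : ℂ) * (1 - χ₁) - (c₁ y : ℂ) * (y - θ - χ y)) (Ici 0) y := by
  have d0 : HasDerivWithinAt (fun y => (c y : ℂ)) (c₁ y : ℂ) (Ici 0) y :=
    (h.hasDeriv y hy).ofReal_comp
  have did : HasDerivWithinAt (fun y : ℝ => (y : ℂ)) 1 (Ici 0) y := by
    simpa using (hasDerivWithinAt_id y (Ici 0)).ofReal_comp
  have cc := h.continuous
  have cc1 := h.continuous_deriv
  have d1 := hasDerivWithinAt_tailIntegral (f := fun z => (c z : ℂ)) (by fun_prop)
    (integrableOn_ofReal h.integrable) hy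
  have d2 := hasDerivWithinAt_tailIntegral (f := fun z => (c₁ z : ℂ) * χ z) (by fun_prop)
    (h.integrableOn_deriv_mul χ) hy
  have D := (((did.mul d0).neg.sub (d1.const_mul 2)).add (d0.const_mul (θ : ℂ))).sub
    ((d0.mul hχ).add (d2.const_mul 2))
  have e : ∀ z ∈ Ici (0 : ℝ), h.force θ χ z =
      -((z : ℂ) * (c z : ℂ)) - 2 * tailIntegral (fun z => (c z : ℂ)) z + (θ : ℂ) * (c z : ℂ) -
      ((c z : ℂ) * χ z + 2 * tailIntegral (fun z => (c₁ z : ℂ) * χ z) z) := by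
    intro z hz
    have hz' : (0 : ℝ) ≤ z := hz
    simp only [force_apply, source, coupling, abs_of_nonneg hz']
    push_cast; ring
  refine (D.congr_of_mem (f₁ := h.force θ χ) e hy).congr_deriv ?_
  ring
end IsDefect

/-- The dilation `y ↦ ψ (m y)`. -/
def dilate (m : ℝ) (ψ : ℝ →ᵇ ℂ) : ℝ →ᵇ ℂ := ψ.compContinuous ⟨fun y => m * y, by fun_prop⟩

theorem dilate_apply (m : ℝ) (ψ : ℝ →ᵇ ℂ) (y : ℝ) : dilate m ψ y = ψ (m * y) := rfl

theorem norm_dilate_le (m : ℝ) (ψ : ℝ →ᵇ ℂ) : ‖dilate m ψ‖ ≤ ‖ψ‖ :=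
  (BoundedContinuousFunction.norm_le (norm_nonneg _)).2 fun _ => ψ.norm_coe_le_norm _

theorem dilate_sub (m : ℝ) (ψ ψ' : ℝ →ᵇ ℂ) : dilate m ψ - dilate m ψ' = dilate m (ψ - ψ') := rfl

/-! ### The dispersion relation and the response to a forcing -/

/-- The correction to the reduced dispersion relation due to a forcing with value `-z` at `0`. -/
def dispersionError (z b : ℂ) (J : ℝ →ᵇ ℂ) : ℂ := Complex.I * b * laplace b fun a => J a + z

theorem norm_dispersionError_le {β : ℝ} (hβ : 0 < β) {z b : ℂ} (hb : β ≤ b.re) {A κ : ℝ}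
    (hA : ‖b‖ ≤ A) (hκ : 0 ≤ κ) {J : ℝ →ᵇ ℂ} (hJ : ∀ a, 0 < a → ‖J a + z‖ ≤ κ * (1 + a)) :
    ‖dispersionError z b J‖ ≤ A * (κ * laplaceMoment β) := by
  unfold dispersionError
  rw [norm_mul, norm_mul, Complex.norm_I, one_mul]
  exact mul_le_mul hA (norm_laplace_le hβ hb hκ hJ) (norm_nonneg _) ((norm_nonneg _).trans hA)

theorem norm_dispersionError_sub_le {β : ℝ} (hβ : 0 < β) {z b b' : ℂ} (hb : β ≤ b.re)
    (hb' : β ≤ b'.re) {A κ d : ℝ} (hA : ‖b'‖ ≤ A) (hκ : 0 ≤ κ) (hd : 0 ≤ d) {J J' : ℝ →ᵇ ℂ}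
    (hJ : ∀ a, 0 < a → ‖J a + z‖ ≤ κ * (1 + a)) (hJ' : ∀ a, 0 < a → ‖J' a + z‖ ≤ κ * (1 + a))
    (hJJ' : ‖J - J'‖ ≤ κ * d) :
    ‖dispersionError z b J - dispersionError z b' J'‖ ≤
      (1 + A) * (κ * laplaceMoment β) * (‖b - b'‖ + d) := by
  have hA0 : 0 ≤ A := (norm_nonneg _).trans hA
  have hL := laplaceMoment_nonneg β
  have h1 := norm_laplace_le hβ hb hκ hJ
  have h2 := norm_laplace_sub_le hβ hb hb' (f := fun a => J a + z) (by fun_prop) hκ hJ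
  have h3 : ‖laplace b' (fun a => J a + z) - laplace b' (fun a => J' a + z)‖ ≤
      κ * d * laplaceMoment β := by
    rw [← laplace_sub (hβ.trans_le hb') (by fun_prop) (by fun_prop) hJ hJ']
    refine norm_laplace_le hβ hb' (by positivity) fun a ha => ?_
    refine bound_mul_one_add ?_ ha
    rw [add_sub_add_right_eq_sub]
    exact ((J - J').norm_coe_le_norm a).trans hJJ'
  have key : dispersionError z b J - dispersionError z b' J' =
      Complex.I * ((b - b') * laplace b (fun a => J a + z)
        + b' * ((laplace b (fun a => J a + z) - laplace b' (fun a => J a + z))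
          + (laplace b' (fun a => J a + z) - laplace b' (fun a => J' a + z)))) := by
    unfold dispersionError; ring
  rw [key, norm_mul, Complex.norm_I, one_mul]
  refine (norm_add_le _ _).trans ?_
  rw [norm_mul, norm_mul]
  calc _ ≤ ‖b - b'‖ * (κ * laplaceMoment β)
        + A * (κ * laplaceMoment β * ‖b - b'‖ + κ * d * laplaceMoment β) := by
        gcongr; exact (norm_add_le _ _).trans (add_le_add h2 h3)
    _ ≤ _ := by
        have : 0 ≤ κ * laplaceMoment β * d := by positivity
        nlinarith

/-- `Y ↦ e^{-b|Y|}`. -/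
def expAbs (b : ℂ) (hb : 0 < b.re) : ℝ →ᵇ ℂ :=
  BoundedContinuousFunction.ofNormedAddCommGroup
    (fun Y : ℝ => Complex.exp (-(b * (|Y| : ℝ)))) (by fun_prop) 1 fun Y => by
      refine (norm_cexp_neg_mul_le (le_refl b.re) (abs_nonneg Y)).trans ?_
      rw [Real.exp_le_one_iff]
      have := mul_nonneg hb.le (abs_nonneg Y)
      linarith

theorem norm_expAbs_le (b : ℂ) (hb : 0 < b.re) : ‖expAbs b hb‖ ≤ 1 :=
  BoundedContinuousFunction.norm_ofNormedAddCommGroup_le _ zero_le_one _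

theorem norm_expAbs_sub_le {β : ℝ} (hβ : 0 < β) {b b' : ℂ} (hb : β ≤ b.re) (hb' : β ≤ b'.re) :
    ‖expAbs b (hβ.trans_le hb) - expAbs b' (hβ.trans_le hb')‖ ≤ 1 / β * ‖b - b'‖ := by
  refine (BoundedContinuousFunction.norm_le (by positivity)).2 fun Y => ?_
  refine (norm_cexp_neg_mul_sub_le hb hb' (abs_nonneg Y)).trans ?_
  gcongr
  rw [Real.exp_neg, inv_mul_eq_div, div_le_div_iff₀ (Real.exp_pos _) hβ]
  have := Real.add_one_le_exp (β * |Y|)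
  linarith

/-- The bounded even solution of `ψ'' = b² ψ + i J` with `ψ'(0+) = δ`, for even `J`. -/
def response (δ : ℝ) (b : ℂ) (hb : 0 < b.re) (J : ℝ →ᵇ ℂ) : ℝ →ᵇ ℂ :=
  -((δ / b : ℂ) • expAbs b hb) - Complex.I • helmholtzBCF b hb J

theorem norm_response_le {β : ℝ} (hβ : 0 < β) {b : ℂ} (hb : β ≤ b.re) {δ : ℝ} (hδ : 0 ≤ δ)
    (J : ℝ →ᵇ ℂ) :
    ‖response δ b (hβ.trans_le hb) J‖ ≤ δ / β + ‖J‖ * laplaceMoment β / β := by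
  have hbn : β ≤ ‖b‖ := hb.trans (Complex.re_le_norm b)
  have hL := laplaceMoment_nonneg β
  unfold response
  refine (norm_sub_le _ _).trans ?_
  rw [norm_neg, norm_smul, norm_smul, Complex.norm_I, one_mul, norm_div, Complex.norm_real,
    Real.norm_of_nonneg hδ]
  refine add_le_add ?_ ?_
  · have := norm_expAbs_le b (hβ.trans_le hb)
    calc _ ≤ δ / β * 1 := by gcongr
      _ = _ := mul_one _
  · exact (BoundedContinuousFunction.norm_le (by positivity)).2 fun Y =>
      norm_helmholtz_le hβ hb J.norm_coe_le_norm Y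

theorem norm_response_sub_le {β : ℝ} (hβ : 0 < β) {b b' : ℂ} (hb : β ≤ b.re) (hb' : β ≤ b'.re)
    {δ : ℝ} (hδ : 0 ≤ δ) (J J' : ℝ →ᵇ ℂ) :
    ‖response δ b (hβ.trans_le hb) J - response δ b' (hβ.trans_le hb') J'‖ ≤
      (2 * δ / β ^ 2 + ‖J‖ * laplaceMoment β * (1 / β + 1 / β ^ 2)) * ‖b - b'‖
        + laplaceMoment β / β * ‖J - J'‖ := by
  have hbn : β ≤ ‖b‖ := hb.trans (Complex.re_le_norm b)
  have hbn' : β ≤ ‖b'‖ := hb'.trans (Complex.re_le_norm b')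
  have hb0 : b ≠ 0 := by rintro rfl; simp at hb; linarith
  have hb0' : b' ≠ 0 := by rintro rfl; simp at hb'; linarith
  have hL := laplaceMoment_nonneg β
  have e1 := norm_expAbs_sub_le hβ hb hb'
  have e2 := norm_expAbs_le b' (hβ.trans_le hb')
  have h1 : ‖helmholtzBCF b (hβ.trans_le hb) J - helmholtzBCF b' (hβ.trans_le hb') J‖ ≤
      ‖J‖ * laplaceMoment β * (1 / β + 1 / β ^ 2) * ‖b - b'‖ :=
    (BoundedContinuousFunction.norm_le (by positivity)).2 fun Y =>
      norm_helmholtz_sub_le hβ hb hb' J.continuous J.norm_coe_le_norm Y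
  have h2 : ‖helmholtzBCF b' (hβ.trans_le hb') J - helmholtzBCF b' (hβ.trans_le hb') J'‖ ≤
      ‖J - J'‖ * laplaceMoment β / β :=
    (BoundedContinuousFunction.norm_le (by positivity)).2 fun Y => by
      have := norm_helmholtz_le hβ hb' (J - J').norm_coe_le_norm Y
      rw [helmholtz_sub (hβ.trans_le hb')] at this
      exact this
  -- The exponential, the coefficient δ/b, the parameter of the potential and its argument are
  -- varied one at a time.
  have key : response δ b (hβ.trans_le hb) J - response δ b' (hβ.trans_le hb') J' =
      -(((δ / b : ℂ) • (expAbs b (hβ.trans_le hb) - expAbs b' (hβ.trans_le hb'))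
        + (δ * (b' - b) / (b * b') : ℂ) • expAbs b' (hβ.trans_le hb'))
      + Complex.I • ((helmholtzBCF b (hβ.trans_le hb) J - helmholtzBCF b' (hβ.trans_le hb') J)
        + (helmholtzBCF b' (hβ.trans_le hb') J - helmholtzBCF b' (hβ.trans_le hb') J'))) := by
    have : (δ * (b' - b) / (b * b') : ℂ) = δ / b - δ / b' := by field_simp
    rw [this]
    unfold response
    module
  rw [key, norm_neg]
  refine (norm_add_le _ _).trans ?_
  rw [norm_smul, Complex.norm_I, one_mul]
  have f1 := norm_add_le ((δ / b : ℂ) • (expAbs b (hβ.trans_le hb) - expAbs b' (hβ.trans_le hb')))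
    ((δ * (b' - b) / (b * b') : ℂ) • expAbs b' (hβ.trans_le hb'))
  rw [norm_smul, norm_smul, norm_div, norm_div, norm_mul, norm_mul, Complex.norm_real,
    Real.norm_of_nonneg hδ, norm_sub_rev b' b] at f1
  have f2 : δ / ‖b‖ * ‖expAbs b (hβ.trans_le hb) - expAbs b' (hβ.trans_le hb')‖ ≤
      δ / β * (1 / β * ‖b - b'‖) := by gcongr
  have f3 : δ * ‖b - b'‖ / (‖b‖ * ‖b'‖) * ‖expAbs b' (hβ.trans_le hb')‖ ≤
      δ * ‖b - b'‖ / (β * β) * 1 := by gcongr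
  have f4 := norm_add_le
    (helmholtzBCF b (hβ.trans_le hb) J - helmholtzBCF b' (hβ.trans_le hb') J)
    (helmholtzBCF b' (hβ.trans_le hb') J - helmholtzBCF b' (hβ.trans_le hb') J')
  have g : δ / β * (1 / β * ‖b - b'‖) + δ * ‖b - b'‖ / (β * β) * 1 =
      2 * δ / β ^ 2 * ‖b - b'‖ := by field_simp; ring
  have g' : ‖J - J'‖ * laplaceMoment β / β = laplaceMoment β / β * ‖J - J'‖ := by ring
  rw [add_mul]
  linarith

/-! ### The forcing in the fast variable -/

/-- The forcing in the variable `Y = m y` for the perturbation `χ(y) = θ ψ(m y)`. -/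
def fastForce {c c₁ : ℝ → ℝ} (h : IsDefect c c₁) (θ m : ℝ) (ψ : ℝ →ᵇ ℂ) : ℝ →ᵇ ℂ :=
  dilate m⁻¹ (h.force θ ((θ : ℂ) • dilate m ψ))

theorem norm_smul_dilate_le {θ : ℝ} (hθ : 0 ≤ θ) (m : ℝ) (ψ : ℝ →ᵇ ℂ) : ‖(θ : ℂ) • dilate m ψ‖ ≤ θ * ‖ψ‖ := by
  rw [norm_smul, Complex.norm_real, Real.norm_of_nonneg hθ]
  exact mul_le_mul_of_nonneg_left (norm_dilate_le m ψ) hθ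

theorem norm_fastForce_le {c c₁ : ℝ → ℝ} (h : IsDefect c c₁) {θ m : ℝ} (hθ : 0 ≤ θ)
    (ψ : ℝ →ᵇ ℂ) : ‖fastForce h θ m ψ‖ ≤
    IsDefect.sourceBound c c₁ + θ * (IsDefect.bound c₁ * (1 + 3 * ‖ψ‖)) := by
  refine (norm_dilate_le _ _).trans ((h.norm_force_le θ _).trans ?_)
  rw [abs_of_nonneg hθ]
  have := mul_le_mul_of_nonneg_left (norm_smul_dilate_le hθ m ψ) (IsDefect.bound_nonneg c₁)
  linarith

theorem norm_fastForce_sub_le {c c₁ : ℝ → ℝ} (h : IsDefect c c₁) {θ m : ℝ} (hθ : 0 ≤ θ)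
    (ψ ψ' : ℝ →ᵇ ℂ) : ‖fastForce h θ m ψ - fastForce h θ m ψ'‖ ≤
    3 * IsDefect.bound c₁ * θ * ‖ψ - ψ'‖ := by
  have hK := IsDefect.bound_nonneg c₁
  unfold fastForce
  rw [dilate_sub]
  refine (norm_dilate_le _ _).trans ((h.norm_force_sub_le θ _ _).trans ?_)
  rw [← smul_sub, dilate_sub, mul_assoc _ θ]
  gcongr
  exact norm_smul_dilate_le hθ m _

/-- The source is read at a/m, so its variation carries 1/m; all the other terms carry θ. On the
scale of the layer the forcing is thus nearly constant, with a linear growth that the Laplace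
transform absorbs. -/
theorem norm_fastForce_sub_source_le {c c₁ : ℝ → ℝ} (h : IsDefect c c₁) {θ m : ℝ} (hθ : 0 ≤ θ)
    (hm : 0 < m) (ψ : ℝ →ᵇ ℂ) {a : ℝ} (ha : 0 < a) :
    ‖fastForce h θ m ψ a - IsDefect.source c 0‖ ≤
      (3 * IsDefect.bound c₁ / m + θ * (IsDefect.bound c₁ * (1 + 3 * ‖ψ‖))) * (1 + a) := by
  have hK := IsDefect.bound_nonneg c₁
  have h1 := h.norm_force_sub_source_le θ ((θ : ℂ) • dilate m ψ) (m⁻¹ * a)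
  rw [abs_of_nonneg hθ, abs_of_pos (by positivity)] at h1
  have h2 := mul_le_mul_of_nonneg_left (norm_smul_dilate_le hθ m ψ) hK
  unfold fastForce
  rw [dilate_apply]
  have h3 : 3 * IsDefect.bound c₁ * (m⁻¹ * a) = 3 * IsDefect.bound c₁ / m * a := by
    field_simp
  have h4 : 0 ≤ 3 * IsDefect.bound c₁ / m := by positivity
  have h5 : 0 ≤ θ * (IsDefect.bound c₁ * (1 + 3 * ‖ψ‖)) * a := by positivity
  nlinarith

/-! ### The reduced dispersion relation `b² = δ b - 2 i Δ` -/

/-- Take b₀ = δ/2 + w with w the principal square root of δ²/4 - 2iΔ. From (Re w)² - (Im w)² ≥ 0 and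
Re w · Im w = -Δ follow |Im w| ≤ Re w and |Δ| ≤ (Re w)². The lower bound does not degenerate as δ →
0 and holds for either sign of Δ. -/
theorem exists_reduced_root {Δ : ℝ} {δ : ℝ} (hδ : 0 < δ) (hδ1 : δ ≤ 1) :
    ∃ b₀ : ℂ, b₀ ^ 2 = δ * b₀ - 2 * Complex.I * Δ ∧ √|Δ| + δ / 2 ≤ b₀.re ∧
      ‖b₀‖ ≤ 1 + 2 * |Δ| := by
  set z : ℂ := ((δ ^ 2 / 4 : ℝ) : ℂ) - 2 * Complex.I * Δ with hz
  set w : ℂ := z ^ (1 / 2 : ℂ) with hw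
  have hw2 : w ^ 2 = z := by
    rw [hw, one_div]; exact Complex.cpow_ofNat_inv_pow z 2
  have hre : 0 ≤ w.re := by
    rw [hw, one_div]
    by_cases h0 : z = 0
    · rw [h0, Complex.zero_cpow (by norm_num)]; simp
    have harg : (z ^ (2⁻¹ : ℂ)).arg = z.arg / 2 := by
      rw [Complex.cpow_def_of_ne_zero h0, Complex.arg_exp]
      have him : (Complex.log z * 2⁻¹).im = z.arg / 2 := by
        have : (2⁻¹ : ℂ) = ((2⁻¹ : ℝ) : ℂ) := by push_cast; rfl
        rw [this, Complex.im_mul_ofReal, Complex.log_im]; ring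
      rw [him, toIocMod_eq_self]
      have := Complex.neg_pi_lt_arg z
      have := Complex.arg_le_pi z
      have := Real.pi_pos
      constructor <;> linarith
    rw [← Complex.abs_arg_le_pi_div_two_iff, harg, abs_div, abs_two]
    have := Complex.abs_arg_le_pi z
    linarith
  have zre : z.re = δ ^ 2 / 4 := by
    have := congrArg Complex.re hz
    simpa [Complex.sub_re, Complex.mul_re, Complex.mul_im, ← Complex.ofReal_pow] using! this
  have zim : z.im = -(2 * Δ) := by
    have := congrArg Complex.im hz
    simpa [Complex.sub_im, Complex.mul_re, Complex.mul_im, ← Complex.ofReal_pow] using! this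
  have e1 : w.re ^ 2 - w.im ^ 2 = δ ^ 2 / 4 := by
    have := congrArg Complex.re hw2
    rw [zre, pow_two, Complex.mul_re] at this
    linarith
  have e2 : w.re * w.im = -Δ := by
    have := congrArg Complex.im hw2
    rw [zim, pow_two, Complex.mul_im] at this
    linarith
  have hge : √|Δ| ≤ w.re := by
    refine Real.sqrt_le_iff.2 ⟨hre, ?_⟩
    have h1 : |Δ| = w.re * |w.im| := by rw [← abs_neg, ← e2, abs_mul, abs_of_nonneg hre]
    have h2 : |w.im| ≤ w.re := abs_le_of_sq_le_sq (by nlinarith) hre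
    rw [h1]; nlinarith
  have hroot : (δ / 2 + w) ^ 2 = δ * (δ / 2 + w) - 2 * Complex.I * Δ := by
    have : (δ / 2 + w) ^ 2 = δ ^ 2 / 4 + δ * w + w ^ 2 := by ring
    rw [this, hw2, hz]; push_cast; ring
  refine ⟨δ / 2 + w, hroot, ?_, ?_⟩
  · have : ((δ : ℂ) / 2 + w).re = δ / 2 + w.re := by simp
    rw [this]; linarith
  · set x := ‖(δ / 2 + w : ℂ)‖ with hx
    have hx0 : 0 ≤ x := norm_nonneg _
    have h1 : x ^ 2 ≤ x + 2 * |Δ| := by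
      have h2 := congrArg norm hroot
      rw [norm_pow] at h2
      rw [hx, h2]
      refine (norm_sub_le _ _).trans (add_le_add ?_ ?_)
      · rw [norm_mul, Complex.norm_real, Real.norm_of_nonneg hδ.le]
        exact mul_le_of_le_one_left (norm_nonneg _) hδ1
      · simp
    by_contra! hlt
    have := abs_nonneg Δ
    nlinarith

/-! ### The coupled problem for the growth rate and the profile -/

-- Multiplied by b, the dispersion relation reads b² - δb + 2iΔ = e, with e the `dispersionError`.
-- As b₀ is a root of the left side, this is (b - b₀)(b + b₀ - δ) = e, hence the fixed-point form b
-- = b₀ + e/(b + b₀ - δ). Since e = O(δ/S), this map contracts a disc of radius εδ for large S, and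
-- ψ enters its own equation only through small terms.
set_option maxHeartbeats 400000 in
theorem exists_profile {c c₁ : ℝ → ℝ} (h : IsDefect c c₁) {Δ : ℝ}
    (hΔ : Δ = ∫ y in Ioi (0 : ℝ), c y) (hΔ0 : Δ ≠ 0) {ε : ℝ} (hε : 0 < ε) :
    ∃ δ₀ S : ℝ, 0 < δ₀ ∧ 0 < S ∧ ∀ δ θ m : ℝ, 0 < δ → δ ≤ δ₀ → 0 < θ → 0 < m → θ ≤ δ / S →
      1 / m ≤ δ / S → ∃ (b b₀ : ℂ) (hb : 0 < b.re) (ψ : ℝ →ᵇ ℂ),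
        b₀ ^ 2 = δ * b₀ - 2 * Complex.I * Δ ∧ 0 < b₀.re ∧ ‖b₀‖ ≤ 1 + 2 * |Δ| ∧
        ‖b - b₀‖ ≤ ε * δ ∧ δ * (√|Δ| / 4) ≤ (b ^ 2).re ∧
        b = δ + Complex.I * laplace b (fastForce h θ m ψ) ∧
        ψ = response δ b hb (fastForce h θ m ψ) := by
  set K := IsDefect.bound c₁ with hK
  set sB := IsDefect.sourceBound c c₁ with hsB
  -- Half the lower bound of Re b₀: on the disc of radius εδ ≤ β one keeps Re b ≥ β.
  set β := √|Δ| / 2 with hβd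
  have hβ : 0 < β := by have := Real.sqrt_pos.2 (abs_pos.2 hΔ0); positivity
  set L := laplaceMoment β with hLd
  have hL : 0 ≤ L := laplaceMoment_nonneg β
  have hK0 : 0 ≤ K := IsDefect.bound_nonneg c₁
  have hsB0 : 0 ≤ sB := (norm_nonneg _).trans (h.norm_source_le 0)
  set A := 1 + 2 * |Δ| + β with hA
  have hA0 : 0 ≤ A := by positivity
  -- `M` bounds `response` for δ ≤ 1 and a forcing of norm at most sB + 1. `C₀` δ/S will bound both
  -- the deviation of the forcing from -2Δ, relative to 1 + a, and its Lipschitz constant in ψ; `P`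
  -- δ/S the Lipschitz constant of the map for b; `C` that of `response` in b.
  set M := 1 / β + (sB + 1) * L / β with hM
  have hM0 : 0 ≤ M := by positivity
  set C₀ := 3 * K + K * (1 + 3 * M) with hC₀
  have hC₀0 : 0 ≤ C₀ := by positivity
  set P := C₀ * L * (1 + A) * (1 / β + 1 / β ^ 2) with hP
  have hP0 : 0 ≤ P := by positivity
  set C := 2 / β ^ 2 + (sB + 1) * L * (1 / β + 1 / β ^ 2) with hC
  have hC0 : 0 ≤ C := by positivity
  -- The factor P + C₀ + 1 yields κ₀ ≤ 1 and κ ≤ δ/4, the factor 2C + 1 the contraction of the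
  -- composed map, and 1 + 1/ε the bound κ ≤ εδ that keeps b in its disc.
  set S := 4 * (P + C₀ + 1) * (2 * C + 1) * (1 + 1 / ε) with hS
  have hS0 : 0 < S := by positivity
  clear_value S C P C₀ M A β
  refine ⟨min 1 (min β (β / ε)), S, by positivity, hS0, ?_⟩
  intro δ θ m hδ hδ₀ hθ hm hθS hmS
  have hδ1 : δ ≤ 1 := hδ₀.trans (min_le_left _ _)
  have hδβ : δ ≤ β := hδ₀.trans ((min_le_right _ _).trans (min_le_left _ _))
  have hεδ : ε * δ ≤ β := by
    have : δ ≤ β / ε := hδ₀.trans ((min_le_right _ _).trans (min_le_right _ _))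
    rwa [le_div_iff₀' hε] at this
  obtain ⟨b₀, hroot, hb₀re, hb₀n⟩ := exists_reduced_root (Δ := Δ) hδ hδ1
  set κ₀ := C₀ * (δ / S) with hκ₀
  have hδS : 0 < δ / S := by positivity
  have hκ₀0 : 0 ≤ κ₀ := by positivity
  set κ := P * (δ / S) with hκ
  have hκ0 : 0 ≤ κ := by positivity
  clear_value κ₀ κ
  -- consequences of the choice of `S`
  have hS1 : 4 * (P + C₀ + 1) * (2 * C + 1) ≤ S := by
    rw [hS]; exact le_mul_of_one_le_right (by positivity) (by have : 0 < 1 / ε := by positivity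
                                                              linarith)
  have hS2 : 4 * (P + C₀ + 1) * (2 * C + 1) ≤ S * ε := by
    have : S * ε = 4 * (P + C₀ + 1) * (2 * C + 1) * (ε + 1) := by rw [hS]; field_simp
    rw [this]; exact le_mul_of_one_le_right (by positivity) (by linarith)
  have q1 : 4 * (P * (2 * C + 1)) ≤ 4 * (P + C₀ + 1) * (2 * C + 1) := by
    have : 4 * (P + C₀ + 1) * (2 * C + 1) =
        4 * (P * (2 * C + 1)) + 4 * ((C₀ + 1) * (2 * C + 1)) := by ring
    rw [this]
    exact le_add_of_nonneg_right (by positivity)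
  have q2 : P ≤ P * (2 * C + 1) := le_mul_of_one_le_right hP0 (by linarith)
  have q3 : C₀ ≤ 4 * (P + C₀ + 1) * (2 * C + 1) :=
    le_trans (by linarith) (le_mul_of_one_le_right (by positivity) (by linarith))
  have s1 : κ ≤ ε * δ := by
    rw [hκ, mul_div_assoc', div_le_iff₀ hS0, mul_right_comm ε, mul_comm ε]
    gcongr
    linarith
  have s2 : κ₀ ≤ 1 := by
    rw [hκ₀, mul_div_assoc', div_le_iff₀ hS0, one_mul]
    exact (mul_le_of_le_one_right hC₀0 hδ1).trans (q3.trans hS1)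
  have s3 : 2 * κ ≤ δ / 2 := by
    have : 2 * κ = δ * (2 * P) / S := by rw [hκ]; ring
    rw [this, div_le_iff₀ hS0, div_mul_eq_mul_div, mul_div_assoc]
    gcongr
    linarith
  have s4 : 2 * C * κ + κ ≤ 1 / 2 := by
    have : 2 * C * κ + κ = (P * (2 * C + 1)) * δ / S := by rw [hκ]; ring
    rw [this, div_le_iff₀ hS0]
    have : P * (2 * C + 1) * δ ≤ P * (2 * C + 1) := mul_le_of_le_one_right (by positivity) hδ1
    linarith
  have s5 : κ = κ₀ * L * (1 + A) * (1 / β + 1 / β ^ 2) := by rw [hκ, hκ₀, hP]; ring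
  -- the domain
  have dom (b : ℂ) (hb : ‖b - b₀‖ ≤ ε * δ) : β ≤ b.re ∧ ‖b‖ ≤ A ∧ β ≤ (b + b₀ - δ).re := by
    have h1 : |(b - b₀).re| ≤ β := (Complex.abs_re_le_norm _).trans (hb.trans hεδ)
    rw [Complex.sub_re] at h1
    have h2 := abs_le.1 h1
    have h3 : √|Δ| = 2 * β := by rw [hβd]; ring
    refine ⟨by linarith, ?_, ?_⟩
    · have : b = b₀ + (b - b₀) := by ring
      rw [this]
      rw [hA]
      exact (norm_add_le _ _).trans (add_le_add hb₀n (hb.trans hεδ))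
    · simp only [Complex.sub_re, Complex.add_re, Complex.ofReal_re]
      linarith
  have hsrc : IsDefect.source c 0 = -(2 * Δ : ℂ) := by
    rw [IsDefect.source_zero, ← hΔ]; ring
  have near (ψ : ℝ →ᵇ ℂ) (hψ : ‖ψ‖ ≤ M) (a : ℝ) (ha : 0 < a) :
      ‖fastForce h θ m ψ a + 2 * Δ‖ ≤ κ₀ * (1 + a) := by
    have h1 := norm_fastForce_sub_source_le h hθ.le hm ψ ha
    rw [hsrc, sub_neg_eq_add] at h1
    refine h1.trans ?_
    gcongr
    rw [← hK, hκ₀, hC₀, add_mul]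
    refine add_le_add ?_ ?_
    · calc 3 * K / m = 3 * K * (1 / m) := by ring
        _ ≤ _ := by gcongr
    · rw [mul_comm θ]; gcongr
  have forceBd (ψ : ℝ →ᵇ ℂ) (hψ : ‖ψ‖ ≤ M) : ‖fastForce h θ m ψ‖ ≤ sB + 1 := by
    refine (norm_fastForce_le h hθ.le ψ).trans ?_
    gcongr
    refine le_trans ?_ s2
    rw [← hK, hκ₀, mul_comm θ]
    gcongr
    rw [hC₀]
    have : K * (1 + 3 * ‖ψ‖) ≤ K * (1 + 3 * M) := by gcongr
    linarith
  have forceLip (ψ ψ' : ℝ →ᵇ ℂ) : ‖fastForce h θ m ψ - fastForce h θ m ψ'‖ ≤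
      κ₀ * ‖ψ - ψ'‖ := by
    refine (norm_fastForce_sub_le h hθ.le ψ ψ').trans ?_
    gcongr
    rw [← hK, hκ₀]
    gcongr
    rw [hC₀]
    have : 0 ≤ K * (1 + 3 * M) := by positivity
    linarith
  have hβκ : A * (κ₀ * L) ≤ β * κ := by
    have : β * κ = (1 + A) * (κ₀ * L) * (1 + 1 / β) := by rw [s5]; field_simp
    have h1 : (1 + A) * (κ₀ * L) * (1 + 1 / β) =
        A * (κ₀ * L) + (κ₀ * L + (1 + A) * (κ₀ * L) * (1 / β)) := by ring
    rw [this, h1]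
    exact le_add_of_nonneg_right (by positivity)
  have errBd (b : ℂ) (ψ : ℝ →ᵇ ℂ) (hb : ‖b - b₀‖ ≤ ε * δ) (hψ : ‖ψ‖ ≤ M) :
      ‖dispersionError (2 * Δ) b (fastForce h θ m ψ)‖ ≤ A * (κ₀ * L) :=
    norm_dispersionError_le hβ (dom b hb).1 (dom b hb).2.1 hκ₀0 (near ψ hψ)
  have denom (b : ℂ) (hb : ‖b - b₀‖ ≤ ε * δ) : β ≤ ‖b + b₀ - δ‖ ∧ b + b₀ - δ ≠ 0 := by
    have := (dom b hb).2.2.trans (Complex.re_le_norm _)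
    exact ⟨this, norm_pos_iff.1 (hβ.trans_le this)⟩
  obtain ⟨b, ψ, hb, hψ, f1, f2⟩ := exists_coupled_fixedPoint (b₀ := b₀) (r := ε * δ) (M := M)
    (κ := κ) (C := C) (by positivity) hM0 hκ0 hC0
    (fun b ψ => b₀ + dispersionError (2 * Δ) b (fastForce h θ m ψ) / (b + b₀ - δ))
    -- The value 0 is never met: Re b ≥ β on the disc.
    (fun b ψ => if hb : 0 < b.re then response δ b hb (fastForce h θ m ψ) else 0)
    (fun b ψ hb hψ => by
      rw [add_sub_cancel_left, norm_div, div_le_iff₀ (hβ.trans_le (denom b hb).1)]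
      refine (errBd b ψ hb hψ).trans (hβκ.trans ?_)
      rw [mul_comm β]
      exact mul_le_mul s1 (denom b hb).1 hβ.le (by positivity))
    (fun b ψ hb hψ => by
      rw [dif_pos (hβ.trans_le (dom b hb).1)]
      refine (norm_response_le hβ (dom b hb).1 hδ.le _).trans ?_
      rw [hM]
      have := forceBd ψ hψ
      gcongr)
    (fun b ψ b' ψ' hb hψ hb' hψ' => by
      have h1 := norm_dispersionError_sub_le hβ (z := 2 * Δ) (dom b hb).1 (dom b' hb').1
        (dom b' hb').2.1 hκ₀0 (norm_nonneg (ψ - ψ')) (near ψ hψ) (near ψ' hψ') (forceLip ψ ψ')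
      have h2 := errBd b' ψ' hb' hψ'
      have d1 := denom b hb
      have d2 := denom b' hb'
      set e := dispersionError (2 * Δ) b (fastForce h θ m ψ)
      set e' := dispersionError (2 * Δ) b' (fastForce h θ m ψ')
      have key : b₀ + e / (b + b₀ - δ) - (b₀ + e' / (b' + b₀ - δ)) =
          (e - e') / (b + b₀ - δ) - e' * ((b - b') / ((b + b₀ - δ) * (b' + b₀ - δ))) := by
        have d1' := d1.2
        have d2' := d2.2
        field_simp; ring
      rw [key]
      refine (norm_sub_le _ _).trans ?_
      rw [norm_div, norm_mul e', norm_div, norm_mul]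
      calc _ ≤ (1 + A) * (κ₀ * L) * (‖b - b'‖ + ‖ψ - ψ'‖) / β
            + A * (κ₀ * L) * (‖b - b'‖ / (β * β)) := by
            gcongr
            exacts [d1.1, d1.1, d2.1]
        _ ≤ (1 + A) * (κ₀ * L) * (‖b - b'‖ + ‖ψ - ψ'‖) / β
            + (1 + A) * (κ₀ * L) * ((‖b - b'‖ + ‖ψ - ψ'‖) / (β * β)) := by
            gcongr
            · linarith
            · linarith [norm_nonneg (ψ - ψ')]
        _ = _ := by rw [s5]; field_simp)
    (fun b ψ b' ψ' hb hψ hb' hψ' => by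
      rw [dif_pos (hβ.trans_le (dom b hb).1), dif_pos (hβ.trans_le (dom b' hb').1)]
      refine (norm_response_sub_le hβ (dom b hb).1 (dom b' hb').1 hδ.le _ _).trans ?_
      have g1 := forceBd ψ hψ
      have g2 := forceLip ψ ψ'
      have g3 : L / β * κ₀ ≤ κ := by
        have : κ = L / β * κ₀ * ((1 + A) * (1 + 1 / β)) := by rw [s5]; field_simp
        rw [this]
        refine le_mul_of_one_le_right (by positivity) ?_
        have : 0 < 1 / β := by positivity
        exact one_le_mul_of_one_le_of_one_le (by linarith) (by linarith)
      calc _ ≤ (2 * 1 / β ^ 2 + (sB + 1) * L * (1 / β + 1 / β ^ 2)) * ‖b - b'‖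
            + L / β * (κ₀ * ‖ψ - ψ'‖) := by gcongr
        _ = C * ‖b - b'‖ + L / β * κ₀ * ‖ψ - ψ'‖ := by rw [hC]; ring
        _ ≤ _ := by gcongr)
    (by linarith) s4
  have hbre := hβ.trans_le (dom b hb).1
  have hb0 : b ≠ 0 := by rintro rfl; simp at hbre
  rw [dif_pos hbre] at f2
  have hb₀pos : 0 < b₀.re := lt_of_lt_of_le (by positivity) hb₀re
  have he := errBd b ψ hb hψ
  set e := dispersionError (2 * Δ) b (fastForce h θ m ψ) with hedef
  have heq : b ^ 2 = δ * b - 2 * Complex.I * Δ + e := by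
    have : e = (b - b₀) * (b + b₀ - δ) := by
      have h1 : e / (b + b₀ - δ) = b - b₀ := eq_sub_of_add_eq' f1
      rw [← h1, div_mul_cancel₀ _ (denom b hb).2]
    rw [this]
    linear_combination hroot
  refine ⟨b, b₀, hbre, ψ, hroot, hb₀pos, hb₀n, hb, ?_, ?_, f2.symm⟩
  -- The term -2iΔ has no real part, so the growth comes from δb: Re(δb) ≥ δβ, while |e| ≤ δβ/4.
  · have h1 : (b ^ 2).re = δ * b.re + e.re := by
      rw [heq]; simp
    have h2 : |e.re| ≤ β * κ := (Complex.abs_re_le_norm e).trans (he.trans hβκ)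
    have h3 := (abs_le.1 h2).1
    have h4 : β * κ ≤ β * (δ / 4) := by gcongr; linarith
    have h5 : δ * β ≤ δ * b.re := by gcongr; exact (dom b hb).1
    rw [h1]
    have : √|Δ| = 2 * β := by rw [hβd]; ring
    rw [this]
    have : 0 < δ * β := by positivity
    linarith
  -- Dividing the quadratic by b returns the exact relation, since the transform of the constant -2Δ
  -- is -2Δ/b.
  · have h1 : e = Complex.I * b * (laplace b (fastForce h θ m ψ) + 2 * Δ / b) := by
      rw [hedef, dispersionError]
      congr 1
      have := laplace_sub hbre (f := fastForce h θ m ψ) (g := fun _ => -(2 * Δ : ℂ))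
        (M := ‖fastForce h θ m ψ‖) (N := ‖-(2 * Δ : ℂ)‖) (by fun_prop) (by fun_prop)
        (fun a ha => bound_mul_one_add ((fastForce h θ m ψ).norm_coe_le_norm _) ha)
        (fun a ha => bound_mul_one_add le_rfl ha)
      simp only [sub_neg_eq_add] at this
      rw [this, laplace_const hbre]; ring
    have h2 : b * b = b * (δ + Complex.I * laplace b (fastForce h θ m ψ)) := by
      rw [← pow_two, heq, h1]; field_simp; ring
    exact mul_left_cancel₀ hb0 h2

/-! ### Integrability of the derivative of the potential -/

/-- It is the convolution of g with the integrable kernel e^{-ba} on a > 0. -/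
theorem integrable_backwardLaplace {b : ℂ} (hb : 0 < b.re) {g : ℝ → ℂ} (hg : Integrable g) :
    Integrable (backwardLaplace b g) := by
  have hk : Integrable ((Ioi (0 : ℝ)).indicator fun a : ℝ => Complex.exp (-(b * a))) := by
    rw [integrable_indicator_iff measurableSet_Ioi]
    have := integrableOn_laplace hb (f := fun _ => 1) (by fun_prop) (M := 1)
      (fun a ha => bound_mul_one_add (by simp) ha)
    simpa using this
  refine (hk.integrable_convolution (ContinuousLinearMap.mul ℝ ℂ) hg).congr
    (Eventually.of_forall fun Y => ?_)
  unfold backwardLaplace laplace convolution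
  rw [← integral_indicator measurableSet_Ioi]
  congr 1; funext a
  by_cases ha : a ∈ Ioi (0 : ℝ) <;> simp [ha]

theorem integrable_forwardLaplace {b : ℂ} (hb : 0 < b.re) {g : ℝ → ℂ} (hg : Integrable g) :
    Integrable (forwardLaplace b g) := by
  have h := (integrable_backwardLaplace hb hg.comp_neg).comp_neg
  refine h.congr (Eventually.of_forall fun Y => ?_)
  simp only [backwardLaplace_eq, neg_neg]

theorem hasDerivAt_cexp_mul (b : ℂ) (Y : ℝ) :
    HasDerivAt (fun y : ℝ => Complex.exp (b * y)) (b * Complex.exp (b * Y)) Y := by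
  have h : HasDerivAt (fun y : ℝ => b * (y : ℂ)) b Y := by
    simpa using! (Complex.ofRealCLM.hasDerivAt (x := Y)).const_mul b
  simpa [mul_comm] using h.cexp

theorem tendsto_cexp_neg_mul {b : ℂ} (hb : 0 < b.re) :
    Tendsto (fun Y : ℝ => Complex.exp (-b * Y)) atTop (𝓝 0) := by
  rw [tendsto_zero_iff_norm_tendsto_zero]
  have : (fun z : ℝ => ‖Complex.exp (-b * z)‖) = fun z => Real.exp (-(b.re * z)) := by
    funext z; rw [Complex.norm_exp]; simp
  rw [this]
  exact Real.tendsto_exp_neg_atTop_nhds_zero.comp (tendsto_id.const_mul_atTop hb)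

theorem integrableOn_cexp_neg_mul_Ioi {b : ℂ} (hb : 0 < b.re) :
    IntegrableOn (fun Y : ℝ => Complex.exp (-b * Y)) (Ioi 0) := by
  have := integrableOn_laplace hb (f := fun _ => 1) (by fun_prop) (M := 1)
    (fun a ha => bound_mul_one_add (by simp) ha)
  simpa using this

/-- J' is integrable but J need not be. The bounded function u = `forwardLaplace b J` - J/b solves
u' = bu - J'/b, so u is the forward transform of J'/b. In the difference of forward and backward
transforms the terms J/b cancel, which is how 1 - U becomes integrable. -/
theorem integrableOn_forwardLaplace_sub {b : ℂ} (hb : 0 < b.re) {J J₁ : ℝ → ℂ} (hJ : Continuous J)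
    {M : ℝ} (hM : ∀ y, ‖J y‖ ≤ M) (hd : ∀ y, 0 < y → HasDerivAt J (J₁ y) y)
    (hi : IntegrableOn J₁ (Ioi 0)) :
    IntegrableOn (fun Y => forwardLaplace b J Y - J Y / b) (Ioi 0) := by
  have hb0 : b ≠ 0 := by rintro rfl; simp at hb
  have hg : Integrable ((Ioi (0 : ℝ)).indicator J₁) := (integrable_indicator_iff measurableSet_Ioi).2 hi
  refine IntegrableOn.congr_fun
    (((integrable_forwardLaplace hb hg).div_const b).integrableOn) (fun Y hY => ?_) measurableSet_Ioi
  have hY' : (0 : ℝ) < Y := hY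
  have dv (z : ℝ) (hz : 0 < z) : HasDerivAt
      (fun z : ℝ => Complex.exp (-b * z) * (forwardLaplace b J z - J z / b))
      (-(Complex.exp (-b * z) * J₁ z) / b) z := by
    refine ((hasDerivAt_cexp_mul (-b) z).mul
      ((hasDerivAt_forwardLaplace hb hJ hM z).sub ((hd z hz).div_const b))).congr_deriv ?_
    simp only [Pi.sub_apply]
    field_simp; ring
  have hint : IntegrableOn (fun z : ℝ => -(Complex.exp (-b * z) * J₁ z) / b) (Ioi Y) := by
    refine Integrable.div_const (Integrable.neg ?_) b
    refine Integrable.bdd_mul (c := 1) (IntegrableOn.mono_set hi (Ioi_subset_Ioi hY'.le))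
      (Continuous.aestronglyMeasurable (by fun_prop)) ?_
    filter_upwards [ae_restrict_mem measurableSet_Ioi] with a ha
    have ha' : 0 < a := hY'.trans ha
    rw [neg_mul]
    refine (norm_cexp_neg_mul_le (le_refl b.re) ha'.le).trans ?_
    rw [Real.exp_le_one_iff]
    have := mul_pos hb ha'
    linarith
  have hlim : Tendsto (fun z : ℝ => Complex.exp (-b * z) * (forwardLaplace b J z - J z / b)) atTop
      (𝓝 0) := by
    refine (tendsto_cexp_neg_mul hb).zero_mul_isBoundedUnder_le
      (isBoundedUnder_of ⟨M * laplaceMoment b.re + M / ‖b‖, fun z => ?_⟩)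
    refine (norm_sub_le _ _).trans (add_le_add ?_ ?_)
    · exact norm_laplace_le hb le_rfl ((norm_nonneg _).trans (hM 0))
        fun a ha => bound_mul_one_add (hM _) ha
    · rw [norm_div]; gcongr; exact hM z
  have key := integral_Ioi_of_hasDerivAt_of_tendsto (a := Y) (m := 0)
    (dv Y hY').continuousAt.continuousWithinAt (fun z hz => dv z (hY'.trans hz)) hint hlim
  have e1 : ∫ z in Ioi Y, Complex.exp (-(b * z)) * (Ioi (0 : ℝ)).indicator J₁ z =
      ∫ z in Ioi Y, Complex.exp (-b * z) * J₁ z := by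
    refine setIntegral_congr_fun measurableSet_Ioi fun z hz => ?_
    have hz' : z ∈ Ioi (0 : ℝ) := hY'.trans hz
    simp only [indicator_of_mem hz', neg_mul]
  rw [forwardLaplace_eq, e1]
  rw [integral_div, integral_neg] at key
  have e2 : Complex.exp (b * Y) * Complex.exp (-b * Y) = 1 := by
    rw [← Complex.exp_add]; simp
  rw [neg_mul] at e2
  have e3 : ∫ z in Ioi Y, Complex.exp (-b * z) * J₁ z =
      b * (Complex.exp (-b * Y) * (forwardLaplace b J Y - J Y / b)) := by
    field_simp at key ⊢
    linear_combination -key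
  rw [e3]
  field_simp
  linear_combination (forwardLaplace b J Y * b - J Y) * e2

/-- Here v = `backwardLaplace b J` - J/b solves v' = -bv - J'/b. J is differentiable only for y > 0,
so the equation is integrated from 0, which adds v(0)e^{-bY}. -/
theorem integrableOn_backwardLaplace_sub {b : ℂ} (hb : 0 < b.re) {J J₁ : ℝ → ℂ} (hJ : Continuous J)
    {M : ℝ} (hM : ∀ y, ‖J y‖ ≤ M) (hd : ∀ y, 0 < y → HasDerivAt J (J₁ y) y)
    (hi : IntegrableOn J₁ (Ioi 0)) :
    IntegrableOn (fun Y => backwardLaplace b J Y - J Y / b) (Ioi 0) := by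
  have hb0 : b ≠ 0 := by rintro rfl; simp at hb
  have hg : Integrable ((Ioi (0 : ℝ)).indicator J₁) := (integrable_indicator_iff measurableSet_Ioi).2 hi
  set v : ℝ → ℂ := fun Y => backwardLaplace b J Y - J Y / b with hv
  have hexp : IntegrableOn (fun Y : ℝ => v 0 * Complex.exp (-(b * Y))) (Ioi 0) := by
    simp only [← neg_mul]
    exact (integrableOn_cexp_neg_mul_Ioi hb).const_mul _
  refine IntegrableOn.congr_fun
    (hexp.sub ((integrable_backwardLaplace hb hg).div_const b).integrableOn) (fun Y hY => ?_)
    measurableSet_Ioi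
  have hY' : (0 : ℝ) < Y := hY
  have hvc : Continuous v := by
    have h1 : Continuous (backwardLaplace b J) := continuous_iff_continuousAt.2 fun Y =>
      (hasDerivAt_backwardLaplace hb hJ hM Y).continuousAt
    fun_prop
  have dv (z : ℝ) (hz : 0 < z) : HasDerivAt (fun z : ℝ => Complex.exp (b * z) * v z)
      (-(Complex.exp (b * z) * J₁ z) / b) z := by
    refine ((hasDerivAt_cexp_mul b z).mul
      ((hasDerivAt_backwardLaplace hb hJ hM z).sub ((hd z hz).div_const b))).congr_deriv ?_
    simp only [Pi.sub_apply]
    field_simp; ring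
  have hint : IntegrableOn (fun z : ℝ => Complex.exp (b * z) * J₁ z) (Ioc 0 Y) := by
    refine Integrable.bdd_mul (c := Real.exp (b.re * Y))
      (IntegrableOn.mono_set hi Ioc_subset_Ioi_self)
      (Continuous.aestronglyMeasurable (by fun_prop)) ?_
    filter_upwards [ae_restrict_mem measurableSet_Ioc] with a ha
    rw [Complex.norm_exp]
    simp only [Complex.mul_re, Complex.ofReal_re, Complex.ofReal_im, mul_zero, sub_zero]
    have := ha.2
    gcongr
  have key := intervalIntegral.integral_eq_sub_of_hasDerivAt_of_le hY'.le
    (f := fun z : ℝ => Complex.exp (b * z) * v z) (Continuous.continuousOn (by fun_prop))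
    (fun z hz => dv z hz.1)
    ((intervalIntegrable_iff_integrableOn_Ioc_of_le hY'.le).2 (hint.neg.div_const b))
  have e1 : backwardLaplace b ((Ioi (0 : ℝ)).indicator J₁) Y =
      Complex.exp (-(b * Y)) * ∫ z in (0 : ℝ)..Y, Complex.exp (b * z) * J₁ z := by
    rw [backwardLaplace_eq, forwardLaplace_eq]
    have h1 := integral_comp_neg_Ioi (-Y)
      (fun z : ℝ => Complex.exp (b * z) * (Ioi (0 : ℝ)).indicator J₁ z)
    simp only [Complex.ofReal_neg, mul_neg, neg_neg] at h1 ⊢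
    rw [h1, intervalIntegral.integral_of_le hY'.le]
    congr 1
    have h2 : (fun z : ℝ => Complex.exp (b * z) * (Ioi (0 : ℝ)).indicator J₁ z) =
        (Ioi (0 : ℝ)).indicator fun z : ℝ => Complex.exp (b * z) * J₁ z := by
      funext z
      by_cases hz : z ∈ Ioi (0 : ℝ) <;> simp [hz]
    rw [h2, setIntegral_indicator measurableSet_Ioi, inter_comm, Ioi_inter_Iic]
  rw [intervalIntegral.integral_div, intervalIntegral.integral_neg] at key
  simp only [Complex.ofReal_zero, mul_zero, Complex.exp_zero, one_mul] at key
  have e2 : Complex.exp (-(b * Y)) * Complex.exp (b * Y) = 1 := by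
    rw [← Complex.exp_add]; simp
  have e3 : ∫ z in (0 : ℝ)..Y, Complex.exp (b * z) * J₁ z =
      b * (v 0 - Complex.exp (b * Y) * v Y) := by
    field_simp at key
    linear_combination -key
  simp only [Pi.sub_apply]
  rw [e1, e3]
  field_simp
  linear_combination v Y * e2

/-! ### The profile of the unstable mode -/

/-- The smooth extension of `response` from the half line to the line. -/
def responseExt (δ : ℝ) (b : ℂ) (J : ℝ → ℂ) (Y : ℝ) : ℂ :=
  -(δ / b * Complex.exp (-b * Y)) - Complex.I * helmholtz b J Y

/-- The derivative of `responseExt`. -/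
def responseDeriv (δ : ℝ) (b : ℂ) (J : ℝ → ℂ) (Y : ℝ) : ℂ :=
  δ * Complex.exp (-b * Y) - Complex.I * ((forwardLaplace b J Y - backwardLaplace b J Y) / 2)

section response
variable {δ : ℝ} {b : ℂ} {J : ℝ → ℂ} {M : ℝ}

theorem hasDerivAt_responseExt (hb : 0 < b.re) (hJ : Continuous J) (hM : ∀ y, ‖J y‖ ≤ M) (Y : ℝ) :
    HasDerivAt (responseExt δ b J) (responseDeriv δ b J Y) Y := by
  have hb0 : b ≠ 0 := by rintro rfl; simp at hb
  refine ((((hasDerivAt_cexp_mul (-b) Y).const_mul (δ / b : ℂ)).neg).sub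
    ((hasDerivAt_helmholtz hb hJ hM Y).const_mul Complex.I)).congr_deriv ?_
  unfold responseDeriv
  field_simp

theorem hasDerivAt_responseDeriv (hb : 0 < b.re) (hJ : Continuous J) (hM : ∀ y, ‖J y‖ ≤ M)
    (Y : ℝ) : HasDerivAt (responseDeriv δ b J)
      (b ^ 2 * responseExt δ b J Y + Complex.I * J Y) Y := by
  have hb0 : b ≠ 0 := by rintro rfl; simp at hb
  refine (((hasDerivAt_cexp_mul (-b) Y).const_mul (δ : ℂ)).sub
    ((hasDerivAt_deriv_helmholtz hb hJ hM Y).const_mul Complex.I)).congr_deriv ?_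
  unfold responseExt
  field_simp; ring

theorem tendsto_responseExt (hb : 0 < b.re) (hJ : Continuous J) (hM : ∀ y, ‖J y‖ ≤ M)
    (h0 : Tendsto J atTop (𝓝 0)) : Tendsto (responseExt δ b J) atTop (𝓝 0) := by
  have h1 := (tendsto_cexp_neg_mul hb).const_mul (δ / b : ℂ)
  have h2 := (((tendsto_forwardLaplace_zero hb hJ hM h0).add
    (tendsto_backwardLaplace_zero hb hJ hM h0)).div_const (2 * b)).const_mul Complex.I
  have h3 := h1.neg.sub h2
  simp only [mul_zero, zero_div, add_zero, neg_zero, sub_zero] at h3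
  exact h3

theorem tendsto_responseDeriv (hb : 0 < b.re) (hJ : Continuous J) (hM : ∀ y, ‖J y‖ ≤ M)
    (h0 : Tendsto J atTop (𝓝 0)) : Tendsto (responseDeriv δ b J) atTop (𝓝 0) := by
  have h1 := (tendsto_cexp_neg_mul hb).const_mul (δ : ℂ)
  have h2 := (((tendsto_forwardLaplace_zero hb hJ hM h0).sub
    (tendsto_backwardLaplace_zero hb hJ hM h0)).div_const 2).const_mul Complex.I
  have h3 := h1.sub h2
  simp only [mul_zero, zero_div, sub_zero] at h3
  exact h3

theorem exists_norm_responseDeriv_le (hb : 0 < b.re) (hM : ∀ y, ‖J y‖ ≤ M) :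
    ∃ C, ∀ Y, 0 ≤ Y → ‖responseDeriv δ b J Y‖ ≤ C := by
  refine ⟨|δ| * 1 + (M * laplaceMoment b.re + M * laplaceMoment b.re) / 2, fun Y hY => ?_⟩
  have hM0 : 0 ≤ M := (norm_nonneg _).trans (hM 0)
  unfold responseDeriv
  refine (norm_sub_le _ _).trans (add_le_add ?_ ?_)
  · rw [norm_mul, Complex.norm_real, Real.norm_eq_abs, neg_mul]
    gcongr
    refine (norm_cexp_neg_mul_le (le_refl b.re) hY).trans ?_
    rw [Real.exp_le_one_iff]
    have := mul_nonneg hb.le hY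
    linarith
  · rw [norm_mul, Complex.norm_I, one_mul, norm_div, Complex.norm_ofNat]
    gcongr
    exact (norm_sub_le _ _).trans (add_le_add
      (norm_laplace_le hb le_rfl hM0 fun a ha => bound_mul_one_add (hM _) ha)
      (norm_laplace_le hb le_rfl hM0 fun a ha => bound_mul_one_add (hM _) ha))

theorem integrableOn_responseDeriv {J₁ : ℝ → ℂ} (hb : 0 < b.re) (hJ : Continuous J)
    (hM : ∀ y, ‖J y‖ ≤ M) (hd : ∀ y, 0 < y → HasDerivAt J (J₁ y) y)
    (hi : IntegrableOn J₁ (Ioi 0)) : IntegrableOn (responseDeriv δ b J) (Ioi 0) := by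
  have h := ((integrableOn_cexp_neg_mul_Ioi hb).const_mul (δ : ℂ)).sub
    ((((integrableOn_forwardLaplace_sub hb hJ hM hd hi).sub
      (integrableOn_backwardLaplace_sub hb hJ hM hd hi)).div_const 2).const_mul Complex.I)
  refine h.congr (Eventually.of_forall fun Y => ?_)
  simp only [Pi.sub_apply, responseDeriv]
  ring

/-- For even J both transforms agree at 0, and the value is -(δ + i `laplace b J`)/b. The dispersion
relation is thus exactly the condition φ(0) = 0. -/
theorem responseExt_zero (hb : 0 < b.re) (heven : ∀ y, J (-y) = J y)
    (hbeq : b = δ + Complex.I * laplace b J) : responseExt δ b J 0 = -1 := by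
  have hb0 : b ≠ 0 := by rintro rfl; simp at hb
  have h1 : responseExt δ b J 0 = -((δ + Complex.I * laplace b J) / b) := by
    simp only [responseExt, helmholtz, forwardLaplace, backwardLaplace, zero_add, zero_sub, heven]
    simp; field_simp; ring
  rw [h1, ← hbeq, div_self hb0]

theorem responseDeriv_zero (heven : ∀ y, J (-y) = J y) : responseDeriv δ b J 0 = δ := by
  simp [responseDeriv, forwardLaplace, backwardLaplace, heven]
end response

theorem response_apply {δ : ℝ} {b : ℂ} (hb : 0 < b.re) (J : ℝ →ᵇ ℂ) {Y : ℝ} (hY : 0 ≤ Y) :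
    response δ b hb J Y = responseExt δ b J Y := by
  have : response δ b hb J Y =
      -(δ / b * Complex.exp (-(b * (|Y| : ℝ)))) - Complex.I * helmholtz b J Y := rfl
  rw [this, abs_of_nonneg hY, ← neg_mul b]; rfl

theorem hasDerivAt_comp_const_mul {f : ℝ → ℂ} {f' : ℂ} {m y : ℝ} (hf : HasDerivAt f f' (m * y)) :
    HasDerivAt (fun y => f (m * y)) (m * f') y := by
  have h := hf.scomp y ((hasDerivAt_id y).const_mul m)
  simpa [Function.comp_def] using! h

/-- With φ = y - θ - θψ(my), ψ(0) = -1 gives φ(0) = 0, and ψ'(0) = δ with θmδ = 1 gives U(0) = 0.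
Since 1 - U = (θψ(my))', its integral is -θψ(0) = θ. As `response` has a corner at 0, `responseExt`
replaces it; they agree for y ≥ 0. -/
theorem exists_stream_profile {c c₁ : ℝ → ℝ} (h : IsDefect c c₁) {δ θ m k : ℝ} (hm : 0 < m)
    (hδ : θ * m * δ = 1) (hk : θ * m ^ 2 = k) {b : ℂ} (hb : 0 < b.re)
    {ψ : ℝ →ᵇ ℂ} (hbeq : b = δ + Complex.I * laplace b (fastForce h θ m ψ))
    (hψ : ψ = response δ b hb (fastForce h θ m ψ)) :
    ∃ φ U W : ℝ → ℂ, (∀ y, HasDerivAt φ (U y) y) ∧ (∀ y, HasDerivAt U (W y) y) ∧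
      (∀ y, 0 ≤ y → HasDerivWithinAt W
        ((m * b) ^ 2 * (U y - 1) - Complex.I * k * (c y * U y - c₁ y * φ y)) (Ici 0) y) ∧
      φ 0 = 0 ∧ U 0 = 0 ∧ Tendsto U atTop (𝓝 1) ∧ IntegrableOn (fun y => 1 - U y) (Ioi 0) ∧
      ∫ y in Ioi (0 : ℝ), (1 - U y) = θ := by
  set J := fastForce h θ m ψ with hJ
  set χ : ℝ →ᵇ ℂ := (θ : ℂ) • dilate m ψ with hχ
  set F := h.force θ χ with hF
  have hJF (Y : ℝ) : J Y = F (m⁻¹ * Y) := rfl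
  have hJm (y : ℝ) : J (m * y) = F y := by rw [hJF, inv_mul_cancel_left₀ hm.ne']
  have hJc : Continuous J := J.continuous
  have hJM := J.norm_coe_le_norm
  have heven (y : ℝ) : J (-y) = J y := by rw [hJF, hJF, mul_neg, h.force_even]
  have hJ0 : Tendsto J atTop (𝓝 0) :=
    (h.tendsto_force θ χ).comp (tendsto_id.const_mul_atTop (inv_pos.2 hm))
  let U : ℝ → ℂ := fun y => 1 - θ * (m * responseDeriv δ b J (m * y))
  let φ : ℝ → ℂ := fun y => y - θ - θ * responseExt δ b J (m * y)
  let W : ℝ → ℂ := fun y =>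
    -(θ * (m * (m * (b ^ 2 * responseExt δ b J (m * y) + Complex.I * J (m * y)))))
  have did (y : ℝ) : HasDerivAt (fun y : ℝ => (y : ℂ)) 1 y := by
    simpa using (hasDerivAt_id y).ofReal_comp
  have dφ (y : ℝ) : HasDerivAt φ (U y) y :=
    ((did y).sub_const (θ : ℂ)).sub ((hasDerivAt_comp_const_mul
      (hasDerivAt_responseExt hb hJc hJM (m * y))).const_mul (θ : ℂ))
  have dU (y : ℝ) : HasDerivAt U (W y) y :=
    (((hasDerivAt_comp_const_mul
      (hasDerivAt_responseDeriv hb hJc hJM (m * y))).const_mul (m : ℂ)).const_mul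
        (θ : ℂ)).const_sub 1
  have hχφ (y : ℝ) (hy : 0 ≤ y) : χ y = y - θ - φ y := by
    have h1 : χ y = θ * ψ (m * y) := rfl
    have h2 : ψ (m * y) = responseExt δ b J (m * y) := by
      conv_lhs => rw [hψ]
      exact response_apply hb J (mul_nonneg hm.le hy)
    rw [h1, h2]; simp only [φ]; ring
  have dχ (y : ℝ) (hy : 0 ≤ y) : HasDerivWithinAt χ (1 - U y) (Ici 0) y := by
    have h1 : HasDerivWithinAt (fun y : ℝ => (y : ℂ) - θ - φ y) (1 - U y) (Ici 0) y :=
      (((did y).sub_const (θ : ℂ)).sub (dφ y)).hasDerivWithinAt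
    exact h1.congr_of_mem (fun z hz => hχφ z hz) hy
  have dF (y : ℝ) (hy : 0 ≤ y) :
      HasDerivWithinAt F (c y * U y - c₁ y * φ y) (Ici 0) y := by
    refine (h.hasDerivWithinAt_force θ χ hy (dχ y hy)).congr_deriv ?_
    rw [hχφ y hy]; ring
  have hUc : Continuous U := continuous_iff_continuousAt.2 fun y => (dU y).continuousAt
  obtain ⟨C, hC⟩ := exists_norm_responseDeriv_le (δ := δ) hb hJM
  -- φ grows linearly, so the integrability of yc' is essential here.
  have iF : IntegrableOn (fun y => (c y : ℂ) * U y - c₁ y * φ y) (Ioi 0) := by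
    have i1 : IntegrableOn (fun y => (c y : ℂ) * U y) (Ioi 0) := by
      refine Integrable.mul_bdd (c := 1 + |θ| * (|m| * C))
        (IsDefect.integrableOn_ofReal h.integrable) hUc.aestronglyMeasurable ?_
      filter_upwards [ae_restrict_mem measurableSet_Ioi] with y hy
      refine (norm_sub_le _ _).trans (add_le_add (by simp) ?_)
      rw [norm_mul, norm_mul, Complex.norm_real, Complex.norm_real, Real.norm_eq_abs,
        Real.norm_eq_abs]
      gcongr
      exact hC _ (mul_nonneg hm.le (le_of_lt hy))
    have i2 := IsDefect.integrableOn_ofReal h.integrable_mul_deriv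
    have i3 := (IsDefect.integrableOn_ofReal h.integrable_deriv).const_mul (θ : ℂ)
    have i4 := h.integrableOn_deriv_mul χ
    refine IntegrableOn.congr_fun (i1.sub ((i2.sub i3).sub i4)) (fun y hy => ?_) measurableSet_Ioi
    have hy' : 0 ≤ y := le_of_lt hy
    simp only [Pi.sub_apply]
    rw [hχφ y hy']; push_cast; ring
  have dJ (Y : ℝ) (hY : 0 < Y) : HasDerivAt J (((m⁻¹ : ℝ) : ℂ) *
      ((fun y => (c y : ℂ) * U y - c₁ y * φ y) (m⁻¹ * Y))) Y := by
    have hY' : 0 < m⁻¹ * Y := by positivity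
    exact hasDerivAt_comp_const_mul ((dF _ hY'.le).hasDerivAt (Ici_mem_nhds hY'))
  have iJ : IntegrableOn (fun Y => ((m⁻¹ : ℝ) : ℂ) *
      ((fun y => (c y : ℂ) * U y - c₁ y * φ y) (m⁻¹ * Y))) (Ioi 0) := by
    refine Integrable.const_mul ?_ _
    refine (integrableOn_Ioi_comp_mul_left_iff
      (fun y => (c y : ℂ) * U y - c₁ y * φ y) 0 (inv_pos.2 hm)).2 ?_
    rwa [mul_zero]
  have iR : IntegrableOn (responseDeriv δ b J) (Ioi 0) :=
    integrableOn_responseDeriv hb hJc hJM dJ iJ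
  have iU : IntegrableOn (fun y => 1 - U y) (Ioi 0) := by
    have h1 := ((integrableOn_Ioi_comp_mul_left_iff (responseDeriv δ b J) 0 hm).2
      (by rwa [mul_zero])).const_mul (θ * m : ℂ)
    refine h1.congr (Eventually.of_forall fun y => ?_)
    simp only [U]; ring
  have tm : Tendsto (fun y : ℝ => m * y) atTop atTop := tendsto_id.const_mul_atTop hm
  refine ⟨φ, U, W, dφ, dU, fun y hy => ?_, ?_, ?_, ?_, iU, ?_⟩
  · have d1 := ((hasDerivAt_comp_const_mul (hasDerivAt_responseExt (δ := δ) hb hJc hJM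
      (m * y))).const_mul (b ^ 2 : ℂ)).hasDerivWithinAt (s := Ici 0)
    have d2 := (dF y hy).const_mul Complex.I
    have d3 := ((((d1.add d2).const_mul (m : ℂ)).const_mul (m : ℂ)).const_mul (θ : ℂ)).neg
    have e : W = -fun y => (θ : ℂ) * (m * (m *
        ((fun y => b ^ 2 * responseExt δ b J (m * y)) + fun y => Complex.I * F y) y)) := by
      funext z
      simp only [W, hJm, Pi.neg_apply, Pi.add_apply]
    rw [e]
    refine d3.congr_deriv ?_
    have hk' : (k : ℂ) = θ * m ^ 2 := by rw [← hk]; push_cast; ring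
    simp only [U]
    rw [hk']; ring
  · simp only [φ, mul_zero]
    rw [responseExt_zero hb heven hbeq]; simp
  · simp only [U, mul_zero]
    rw [responseDeriv_zero heven, ← mul_assoc]
    have : (θ * m * δ : ℂ) = 1 := by exact_mod_cast hδ
    rw [this, sub_self]
  · have h1 := (((tendsto_responseDeriv (δ := δ) hb hJc hJM hJ0).comp tm).const_mul
      (m : ℂ)).const_mul (θ : ℂ)
    have := h1.const_sub 1
    simpa [U] using! this
  · have t0 : Tendsto (fun y => θ * responseExt δ b J (m * y)) atTop (𝓝 0) := by
      simpa using! ((tendsto_responseExt (δ := δ) hb hJc hJM hJ0).comp tm).const_mul (θ : ℂ)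
    have d0 (y : ℝ) : HasDerivAt (fun y => θ * responseExt δ b J (m * y)) (1 - U y) y := by
      refine ((hasDerivAt_comp_const_mul
        (hasDerivAt_responseExt (δ := δ) hb hJc hJM (m * y))).const_mul (θ : ℂ)).congr_deriv ?_
      simp only [U]; ring
    rw [integral_Ioi_of_hasDerivAt_of_tendsto' (fun y _ => d0 y) iU t0, mul_zero,
      responseExt_zero hb heven hbeq]
    ring

/-! ### Shear flows as defects -/

/-- Since 1/w is integrable, 2|g| ≤ g²w + 1/w suffices. -/
theorem integrable_of_sq_mul_weight {f g w : ℝ → ℝ} (hw1 : ∀ y, 0 ≤ y → 1 ≤ w y)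
    (hw : IntegrableOn (fun y => 1 / w y) (Ioi 0)) (hf : Continuous f)
    (hfg : ∀ y, 0 < y → |f y| ≤ |g y|) (hg : IntegrableOn (fun y => g y ^ 2 * w y) (Ioi 0)) :
    IntegrableOn f (Ioi 0) := by
  refine (hg.add hw).mono' hf.aestronglyMeasurable ?_
  filter_upwards [ae_restrict_mem measurableSet_Ioi] with y hy
  have hy' : 0 < y := hy
  have h1 := hw1 y hy'.le
  have h0 : 0 < w y := by linarith
  refine (hfg y hy').trans ?_
  simp only [Pi.add_apply]
  have h2 : 0 ≤ (|g y| * w y - 1) ^ 2 / w y := by positivity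
  have h3 : (|g y| * w y - 1) ^ 2 / w y = g y ^ 2 * w y - 2 * |g y| + 1 / w y := by
    rw [← sq_abs (g y)]; field_simp; ring
  linarith [abs_nonneg (g y)]

theorem IsShearFlow.hasDerivWithinAt {w Us : ℝ → ℝ} (hUs : IsShearFlow w Us) {y : ℝ} (hy : 0 ≤ y) :
    HasDerivWithinAt Us (derivWithin Us (Ici 0) y) (Ici 0) y :=
  (hUs.smooth.differentiableOn (by simp) y hy).hasDerivWithinAt

theorem IsShearFlow.contDiffOn_derivWithin {w Us : ℝ → ℝ} (hUs : IsShearFlow w Us) :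
    ContDiffOn ℝ ∞ (derivWithin Us (Ici 0)) (Ici 0) :=
  ((contDiffOn_infty_iff_derivWithin (uniqueDiffOn_Ici 0)).1 hUs.smooth).2

theorem IsShearFlow.isDefect {w Us : ℝ → ℝ} (hw : IsWeight w) (hUs : IsShearFlow w Us) :
    IsDefect (fun y => 1 - Us |y|) (fun y => -derivWithin Us (Ici 0) |y|) := by
  have hc : Continuous fun y => 1 - Us |y| :=
    continuous_const.sub (hUs.smooth.continuousOn.comp_continuous continuous_abs fun y => abs_nonneg y)
  have hc₁ : Continuous fun y => -derivWithin Us (Ici 0) |y| :=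
    (hUs.contDiffOn_derivWithin.continuousOn.comp_continuous continuous_abs
      fun y => abs_nonneg y).neg
  have hd (y : ℝ) (hy : 0 < y) : iteratedDeriv 1 Us y = derivWithin Us (Ici 0) |y| := by
    rw [iteratedDeriv_one, abs_of_pos hy, derivWithin_of_mem_nhds (Ici_mem_nhds hy)]
  have h1 := hUs.deriv_sq_integrable 1 (by simp)
  refine ⟨hc, hc₁, fun y => by rw [abs_abs], fun y hy => ?_, ?_, ?_, ?_, ?_⟩
  · rw [abs_of_nonneg hy]
    refine ((hUs.hasDerivWithinAt hy).const_sub 1).congr_of_mem (fun z hz => ?_) hy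
    rw [abs_of_nonneg hz]
  · refine hUs.integrable.congr_fun (fun y hy => ?_) measurableSet_Ioi
    rw [abs_of_pos hy]
  · refine integrable_of_sq_mul_weight hw.one_le hw.integrable_inv hc₁ (fun y hy => ?_) h1
    rw [hd y hy, abs_neg, abs_mul]
    exact le_mul_of_one_le_left (abs_nonneg _) ((by linarith : 1 ≤ 1 + y).trans (le_abs_self _))
  · refine integrable_of_sq_mul_weight hw.one_le hw.integrable_inv (continuous_id.mul hc₁)
      (fun y hy => ?_) h1
    rw [hd y hy, abs_mul (1 + y), abs_of_pos (by linarith : 0 < 1 + y)]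
    simp only [abs_mul, abs_neg, abs_of_pos hy]
    gcongr; linarith
  · have := (hUs.tendsto_one.comp tendsto_abs_atTop_atTop).const_sub 1
    simpa [Function.comp_def] using this

/-- Monotonicity and the limit give U_s ≤ 1, while U_s < 1/2 near 0 by continuity: the integrand is
nonnegative, and positive on an interval. -/
theorem IsShearFlow.displacementThickness_ne_zero {w Us : ℝ → ℝ} (hUs : IsShearFlow w Us)
    (hmono : MonotoneOn Us (Ici 0)) : displacementThickness Us ≠ 0 := by
  have hle (y : ℝ) (hy : 0 ≤ y) : Us y ≤ 1 :=
    ge_of_tendsto hUs.tendsto_one <| by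
      filter_upwards [eventually_ge_atTop y] with z hz using hmono hy (hy.trans hz) hz
  have hcont : ContinuousWithinAt Us (Ici 0) 0 := hUs.smooth.continuousOn 0 self_mem_Ici
  have hev : ∀ᶠ y in 𝓝[≥] (0 : ℝ), Us y < 1 / 2 :=
    hcont.eventually_lt_const (by rw [hUs.zero]; norm_num)
  obtain ⟨r, hr, hrU⟩ := mem_nhdsGE_iff_exists_Ico_subset.1 hev
  have hr' : (0 : ℝ) < r := hr
  refine ne_of_gt ?_
  unfold displacementThickness
  refine (setIntegral_pos_iff_support_of_nonneg_ae ?_ hUs.integrable).2 ?_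
  · filter_upwards [ae_restrict_mem measurableSet_Ioi] with y hy
    have := hle y (le_of_lt hy)
    simp only [Pi.zero_apply]; linarith
  · refine lt_of_lt_of_le ?_ (measure_mono (s := Ioo 0 r) fun y hy => ⟨?_, hy.1⟩)
    · simpa using hr'
    · have : Us y < 1 / 2 := hrU ⟨hy.1.le, hy.2⟩
      rw [Function.mem_support]; linarith

/-! ### Smoothness of the profile -/

theorem ContDiffOn.succ_of_hasDerivWithinAt {n : ℕ} {f f' : ℝ → ℂ} {s : Set ℝ}
    (hs : UniqueDiffOn ℝ s) (h : ∀ y ∈ s, HasDerivWithinAt f (f' y) s y)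
    (hf' : ContDiffOn ℝ n f' s) : ContDiffOn ℝ (n + 1 : ℕ) f s := by
  push_cast
  refine (contDiffOn_succ_iff_derivWithin hs).2
    ⟨fun y hy => (h y hy).differentiableWithinAt, fun h => by simp at h, ?_⟩
  exact hf'.congr fun y hy => (h y hy).derivWithin (hs y hy)

/-- Bootstrap on the first-order system for (φ, U, W): its right side is as smooth as the triple, so
each round gains one derivative. -/
theorem contDiffOn_stream_profile {c c₁ : ℝ → ℂ} (hc : ContDiffOn ℝ ∞ c (Ici 0))
    (hc₁ : ContDiffOn ℝ ∞ c₁ (Ici 0)) {φ U W : ℝ → ℂ} {p q : ℂ}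
    (hφ : ∀ y, HasDerivAt φ (U y) y) (hU : ∀ y, HasDerivAt U (W y) y)
    (hW : ∀ y, 0 ≤ y →
      HasDerivWithinAt W (p * (U y - 1) - q * (c y * U y - c₁ y * φ y)) (Ici 0) y) :
    ContDiffOn ℝ ∞ φ (Ici 0) ∧ ContDiffOn ℝ ∞ U (Ici 0) := by
  have key (n : ℕ) : ContDiffOn ℝ n φ (Ici 0) ∧ ContDiffOn ℝ n U (Ici 0) ∧
      ContDiffOn ℝ n W (Ici 0) := by
    induction n with
    | zero =>
      simp only [Nat.cast_zero, contDiffOn_zero]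
      exact ⟨fun y _ => (hφ y).continuousAt.continuousWithinAt,
        fun y _ => (hU y).continuousAt.continuousWithinAt,
        fun y hy => (hW y hy).continuousWithinAt⟩
    | succ n ih =>
      obtain ⟨i1, i2, i3⟩ := ih
      have hcn : ContDiffOn ℝ n c (Ici 0) := contDiffOn_infty.1 hc n
      have hcn₁ : ContDiffOn ℝ n c₁ (Ici 0) := contDiffOn_infty.1 hc₁ n
      refine ⟨.succ_of_hasDerivWithinAt (uniqueDiffOn_Ici 0)
        (fun y _ => (hφ y).hasDerivWithinAt) i2, .succ_of_hasDerivWithinAt (uniqueDiffOn_Ici 0)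
        (fun y _ => (hU y).hasDerivWithinAt) i3, .succ_of_hasDerivWithinAt (uniqueDiffOn_Ici 0)
        hW ?_⟩
      fun_prop
  exact ⟨contDiffOn_infty.2 fun n => (key n).1, contDiffOn_infty.2 fun n => (key n).2.1⟩

/-! ### Fourier modes -/

theorem integral_cexp_int_mul {k : ℤ} (hk : k ≠ 0) :
    ∫ x in (0 : ℝ)..2 * Real.pi, Complex.exp (Complex.I * k * x) = 0 := by
  have hc : Complex.I * k ≠ 0 := mul_ne_zero Complex.I_ne_zero (Int.cast_ne_zero.2 hk)
  rw [integral_exp_mul_complex hc]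
  have : Complex.I * k * ((2 * Real.pi : ℝ) : ℂ) = k * (2 * Real.pi * Complex.I) := by
    push_cast; ring
  rw [this, Complex.exp_int_mul_two_pi_mul_I]
  simp

theorem periodic_cexp_int_mul (k : ℤ) :
    Function.Periodic (fun x : ℝ => Complex.exp (Complex.I * k * x)) (2 * Real.pi) := by
  intro x
  have : Complex.I * k * ((x + 2 * Real.pi : ℝ) : ℂ) =
      Complex.I * k * x + k * (2 * Real.pi * Complex.I) := by push_cast; ring
  simp only [this, Complex.exp_add, Complex.exp_int_mul_two_pi_mul_I, mul_one]

theorem fourierCoeffOn_cexp_of_ne {k n : ℤ} (h : n ≠ k) :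
    fourierCoeffOn Real.two_pi_pos (fun x => Complex.exp (Complex.I * k * x)) n = 0 := by
  rw [fourierCoeffOn_eq_integral]
  have e : (fun x : ℝ => fourier (-n) (x : AddCircle (2 * Real.pi - 0)) •
      Complex.exp (Complex.I * k * x)) =
      fun x : ℝ => Complex.exp (Complex.I * ((k - n : ℤ) : ℂ) * x) := by
    funext x
    rw [fourier_coe_apply, smul_eq_mul, ← Complex.exp_add]
    congr 1
    have : (Real.pi : ℂ) ≠ 0 := Complex.ofReal_ne_zero.2 Real.pi_ne_zero
    push_cast
    field_simp
    ring
  rw [e, integral_cexp_int_mul (sub_ne_zero.2 h.symm), smul_zero]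

theorem isDirichletToNeumann_cexp {k : ℤ} (hk : 0 < k) (A : ℂ) :
    IsDirichletToNeumann (fun x => A * Complex.exp (Complex.I * k * x))
      (fun x => (k : ℂ) * (A * Complex.exp (Complex.I * k * x))) := by
  have h0 := integral_cexp_int_mul hk.ne'
  have hp := periodic_cexp_int_mul k
  refine ⟨by fun_prop, by fun_prop, fun x => ?_, fun x => ?_, ?_, ?_, fun n => ?_⟩
  · have := hp x
    simp only at this ⊢
    rw [this]
  · have := hp x
    simp only at this ⊢
    rw [this]
  · rw [intervalIntegral.integral_const_mul, h0, mul_zero]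
  · rw [intervalIntegral.integral_const_mul, intervalIntegral.integral_const_mul, h0, mul_zero,
      mul_zero]
  · rw [fourierCoeffOn.const_mul]
    by_cases hn : n = k
    · rw [hn, abs_of_pos hk]
    · rw [fourierCoeffOn.const_mul, fourierCoeffOn_cexp_of_ne hn]; simp

/-! ### The unstable mode -/

/-- The choice V = -ikφ makes the flow incompressible. On the mode k > 0 the operator DN is
multiplication by k, so the coupling is √ν k θ = 1. -/
theorem displaysInstability_of_profile {w Us : ℝ → ℝ} (hUs : IsShearFlow w Us) {ν θ : ℝ} {k : ℤ}
    (hk : 0 < k) (hθ : √ν * k * θ = 1) {s lam : ℂ} (hlam : lam = s - Complex.I * k)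
    (hre : 0 < lam.re) {φ U W : ℝ → ℂ}
    (hφ : ∀ y, HasDerivAt φ (U y) y) (hU : ∀ y, HasDerivAt U (W y) y)
    (hW : ∀ y, 0 ≤ y → HasDerivWithinAt W (s * (U y - 1) - Complex.I * k *
      (((1 - Us |y| : ℝ) : ℂ) * U y - ((-derivWithin Us (Ici 0) |y| : ℝ) : ℂ) * φ y)) (Ici 0) y)
    (hφ0 : φ 0 = 0) (hU0 : U 0 = 0) (hlim : Tendsto U atTop (𝓝 1))
    (hint : IntegrableOn (fun y => 1 - U y) (Ioi 0))
    (hval : ∫ y in Ioi (0 : ℝ), (1 - U y) = θ) :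
    DisplaysInstability (IsLinearizedIBLSolution ν Us) lam k := by
  have cc : ContDiffOn ℝ ∞ (fun y => ((1 - Us |y| : ℝ) : ℂ)) (Ici 0) := by
    have h1 : ContDiffOn ℝ ∞ (fun y => ((1 - Us y : ℝ) : ℂ)) (Ici 0) :=
      Complex.ofRealCLM.contDiff.comp_contDiffOn (contDiffOn_const.sub hUs.smooth)
    exact h1.congr fun y hy => by rw [abs_of_nonneg hy]
  have cc₁ : ContDiffOn ℝ ∞ (fun y => ((-derivWithin Us (Ici 0) |y| : ℝ) : ℂ)) (Ici 0) := by
    have h1 : ContDiffOn ℝ ∞ (fun y => ((-derivWithin Us (Ici 0) y : ℝ) : ℂ)) (Ici 0) :=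
      Complex.ofRealCLM.contDiff.comp_contDiffOn hUs.contDiffOn_derivWithin.neg
    exact h1.congr fun y hy => by rw [abs_of_nonneg hy]
  obtain ⟨sφ, sU⟩ := contDiffOn_stream_profile cc cc₁ hφ hU hW
  have sV : ContDiffOn ℝ ∞ (fun y => -(Complex.I * k * φ y)) (Ici 0) :=
    (contDiffOn_const.mul sφ).neg
  have dt (C : ℂ) (x t : ℝ) : HasDerivAt
      (fun r : ℝ => Complex.exp (lam * r) * Complex.exp (Complex.I * k * x) * C)
      (lam * (Complex.exp (lam * t) * Complex.exp (Complex.I * k * x) * C)) t :=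
    (((hasDerivAt_cexp_mul lam t).mul_const _).mul_const C).congr_deriv (by ring)
  have dx (C : ℂ) (x t : ℝ) : HasDerivAt
      (fun z : ℝ => Complex.exp (lam * t) * Complex.exp (Complex.I * k * z) * C)
      (Complex.I * k * (Complex.exp (lam * t) * Complex.exp (Complex.I * k * x) * C)) x :=
    (((hasDerivAt_cexp_mul (Complex.I * k) x).const_mul _).mul_const C).congr_deriv (by ring)
  have per := periodic_cexp_int_mul k
  have zero := integral_cexp_int_mul hk.ne'
  have smooth {f : ℝ → ℂ} (hf : ContDiffOn ℝ ∞ f (Ici 0)) : ContDiffOn ℝ ∞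
      (fun p : ℝ × ℝ × ℝ => Complex.exp (lam * (p.1 : ℝ)) *
        Complex.exp (Complex.I * k * (p.2.1 : ℝ)) * f p.2.2) (univ ×ˢ univ ×ˢ Ici 0) := by
    have h1 : ContDiff ℝ ∞ (fun p : ℝ × ℝ × ℝ => (p.1 : ℂ)) :=
      Complex.ofRealCLM.contDiff.comp contDiff_fst
    have h2 : ContDiff ℝ ∞ (fun p : ℝ × ℝ × ℝ => (p.2.1 : ℂ)) :=
      Complex.ofRealCLM.contDiff.comp (contDiff_fst.comp contDiff_snd)
    have h3 : ContDiffOn ℝ ∞ (fun p : ℝ × ℝ × ℝ => f p.2.2) (univ ×ˢ univ ×ˢ Ici 0) :=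
      hf.comp (contDiff_snd.comp contDiff_snd).contDiffOn fun p hp => hp.2.2
    exact (((contDiff_const.mul h1).cexp.mul (contDiff_const.mul h2).cexp).contDiffOn).mul h3
  have coup (t : ℝ) (x : ℝ) : ∫ y in Ioi (0 : ℝ),
      (Complex.exp (lam * t) * Complex.exp (Complex.I * k * x) -
        Complex.exp (lam * t) * Complex.exp (Complex.I * k * x) * U y) =
      (Complex.exp (lam * t) * θ) * Complex.exp (Complex.I * k * x) := by
    have e : (fun y => Complex.exp (lam * t) * Complex.exp (Complex.I * k * x) -
        Complex.exp (lam * t) * Complex.exp (Complex.I * k * x) * U y) =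
        fun y => (Complex.exp (lam * t) * Complex.exp (Complex.I * k * x)) * (1 - U y) := by
      funext y; ring
    rw [e, integral_const_mul, hval]; ring
  refine ⟨hk, hre, U, fun y => -(Complex.I * k * φ y), sU, sV, ?_⟩
  refine
    { smooth_U := smooth sU
      smooth_V := smooth sV
      smooth_ue := ?_
      periodic_U := fun t y _ x => by simp only [per x]
      periodic_V := fun t y _ x => by simp only [per x]
      periodic_ue := fun t x => by simp only [per x]
      mean_zero_U := fun t y _ => by
        rw [intervalIntegral.integral_mul_const, intervalIntegral.integral_const_mul, zero]; simp
      mean_zero_V := fun t y _ => by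
        rw [intervalIntegral.integral_mul_const, intervalIntegral.integral_const_mul, zero]; simp
      mean_zero_ue := fun t => by rw [intervalIntegral.integral_const_mul, zero, mul_zero]
      momentum := fun t x y hy => ?_
      incompressible := fun t x y _ => ?_
      bc_U := fun t x => by rw [hU0, mul_zero]
      bc_V := fun t x => by simp only [hφ0, mul_zero, neg_zero]
      tendsto_ue := fun t x => by
        simpa using hlim.const_mul (Complex.exp (lam * t) * Complex.exp (Complex.I * k * x))
      integrable := fun t x => ?_
      coupling := fun t => ?_ }
  · have h1 : ContDiff ℝ ∞ (fun p : ℝ × ℝ => (p.1 : ℂ)) :=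
      Complex.ofRealCLM.contDiff.comp contDiff_fst
    have h2 : ContDiff ℝ ∞ (fun p : ℝ × ℝ => (p.2 : ℂ)) :=
      Complex.ofRealCLM.contDiff.comp contDiff_snd
    exact (contDiff_const.mul h1).cexp.mul (contDiff_const.mul h2).cexp
  · have d1 := (dt 1 x t).deriv
    have d2 := (dx 1 x t).deriv
    simp only [mul_one] at d1 d2
    rw [(dt _ x t).deriv, (dx _ x t).deriv, d1, d2]
    have d3 : iteratedDeriv 2
        (fun z => Complex.exp (lam * t) * Complex.exp (Complex.I * k * x) * U z) y =
        Complex.exp (lam * t) * Complex.exp (Complex.I * k * x) *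
          (s * (U y - 1) - Complex.I * k *
            (((1 - Us |y| : ℝ) : ℂ) * U y - ((-derivWithin Us (Ici 0) |y| : ℝ) : ℂ) * φ y)) := by
      rw [iteratedDeriv_succ, iteratedDeriv_one]
      have e : deriv (fun z => Complex.exp (lam * t) * Complex.exp (Complex.I * k * x) * U z) =
          fun z => Complex.exp (lam * t) * Complex.exp (Complex.I * k * x) * W z :=
        funext fun z => ((hU z).const_mul _).deriv
      rw [e]
      exact (((hW y hy.le).hasDerivAt (Ici_mem_nhds hy)).const_mul _).deriv
    have d4 : deriv Us y = derivWithin Us (Ici 0) y :=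
      (derivWithin_of_mem_nhds (Ici_mem_nhds hy)).symm
    rw [d3, d4, abs_of_pos hy, hlam]
    push_cast
    ring
  · rw [(dx _ x t).deriv]
    have := ((((hφ y).const_mul (Complex.I * k)).neg).const_mul
      (Complex.exp (lam * t) * Complex.exp (Complex.I * k * x))).deriv
    simp only [Pi.neg_apply] at this
    rw [this]; ring
  · refine (hint.const_mul (Complex.exp (lam * t) * Complex.exp (Complex.I * k * x))).congr
      (Eventually.of_forall fun y => ?_)
    simp only; ring
  · have e : (fun x : ℝ => ∫ y in Ioi (0 : ℝ),
        (Complex.exp (lam * t) * Complex.exp (Complex.I * k * x) -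
          Complex.exp (lam * t) * Complex.exp (Complex.I * k * x) * U y)) = _ :=
      funext (coup t)
    refine ⟨_, by rw [e]; exact isDirichletToNeumann_cexp hk _, fun x => ?_⟩
    have h1 : (√ν : ℂ) * k * θ = 1 := by exact_mod_cast hθ
    linear_combination -(Complex.exp (lam * t) * Complex.exp (Complex.I * k * x)) * h1

/-- As Re(δb₀) > 0, the principal root of (δb₀)² is δb₀, so f is (δb₀ - 2iΔ)/(δb₀)² = 1/δ². -/
theorem reducedDispersion_sq {Δ δ : ℝ} (hδ : 0 < δ) {b₀ : ℂ} (hb₀ : 0 < b₀.re)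
    (h : b₀ ^ 2 = δ * b₀ - 2 * Complex.I * Δ) :
    reducedDispersion Δ ((δ * b₀) ^ 2) = (((δ ^ 2)⁻¹ : ℝ) : ℂ) := by
  have hz : 0 < ((δ : ℂ) * b₀).re := by
    rw [Complex.re_ofReal_mul]; positivity
  have hb0 : b₀ ≠ 0 := by rintro rfl; simp at hb₀
  have hδ0 : (δ : ℂ) ≠ 0 := Complex.ofReal_ne_zero.2 hδ.ne'
  unfold reducedDispersion
  rw [Complex.cpow_neg, one_div, Complex.sq_cpow_two_inv hz]
  push_cast
  field_simp
  linear_combination -h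

end

/-! ### The theorem: physical scaling and choice of constants -/

theorem theorem3 (w Us : ℝ → ℝ) (hw : IsWeight w) (hUs : IsShearFlow w Us)
    (hΔ : MonotoneOn Us (Ici 0) ∨ displacementThickness Us ≠ 0)
    (ε : ℝ) (hε : 0 < ε) :
    ∃ νbar K S η : ℝ, 0 < νbar ∧ 0 < K ∧ 0 < S ∧ 0 < η ∧
      ∀ (ν : ℝ) (k : ℤ), 0 < ν → ν ≤ νbar → K ≤ |(k : ℝ)| →
        S ≤ (k : ℝ) * ν ^ (3 / 4 : ℝ) →
        ∃ lam : ℂ,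
          DisplaysInstability (IsLinearizedIBLSolution ν Us) lam k ∧
          η * ν ^ (3 / 4 : ℝ) * (k : ℝ) ^ 2 ≤ lam.re ∧
          ∃ α : ℂ, 0 < α.re ∧
            reducedDispersion (displacementThickness Us) α = ((ν ^ (-(1 / 2) : ℝ) : ℝ) : ℂ) ∧
            ‖lam - α * (k : ℂ) ^ 2‖ ≤ ε * ν ^ (3 / 4 : ℝ) * (k : ℝ) ^ 2 := by
  have hΔ0 : displacementThickness Us ≠ 0 := hΔ.elim hUs.displacementThickness_ne_zero id
  set Δ := displacementThickness Us with hΔd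
  have hdef := hUs.isDefect hw
  have hint : Δ = ∫ y in Ioi (0 : ℝ), (1 - Us |y|) :=
    setIntegral_congr_fun measurableSet_Ioi fun y hy => by
      simp only [abs_of_pos (show (0 : ℝ) < y from hy)]
  have hΔa : 0 < |Δ| := abs_pos.2 hΔ0
  -- Sized for b² - b₀² = (b - b₀)((b - b₀) + 2b₀), whose second factor is at most 1 + 2(1 + 2|Δ|) =
  -- 3 + 4|Δ|.
  set ε₁ := min 1 (ε / (2 * (3 + 4 * |Δ|))) with hε₁
  have hε₁0 : 0 < ε₁ := by positivity
  obtain ⟨δ₀, S₀, hδ₀, hS₀, H⟩ := exists_profile hdef hint hΔ0 hε₁0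
  -- `S₀` makes the contraction work, and 2/ε absorbs the term -ik of λ into half of the allowed
  -- error. Positivity of k follows from the condition on kν^{3/4}, so 1 is enough for K.
  refine ⟨min 1 δ₀ ^ 4, 1, S₀ + 2 / ε, √|Δ| / 4, by positivity, one_pos, by positivity,
    by have := Real.sqrt_pos.2 hΔa; positivity, fun ν k hν hνbar _ hS => ?_⟩
  obtain ⟨δ, hδ, rfl⟩ : ∃ δ : ℝ, 0 < δ ∧ δ ^ 4 = ν :=
    ⟨ν ^ (1 / 4 : ℝ), by positivity, by
      rw [← Real.rpow_natCast, ← Real.rpow_mul hν.le]; norm_num⟩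
  have hδle : δ ≤ min 1 δ₀ := le_of_pow_le_pow_left₀ (by norm_num) (by positivity) hνbar
  have hδ1 : δ ≤ 1 := hδle.trans (min_le_left _ _)
  have p34 : (δ ^ 4) ^ (3 / 4 : ℝ) = δ ^ 3 := by
    rw [← Real.rpow_natCast, ← Real.rpow_mul hδ.le, ← Real.rpow_natCast]; norm_num
  have p12 : (δ ^ 4) ^ (-(1 / 2) : ℝ) = (δ ^ 2)⁻¹ := by
    rw [← Real.rpow_natCast, ← Real.rpow_mul hδ.le, ← Real.rpow_natCast, ← Real.rpow_neg hδ.le]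
    norm_num
  have hsqrt : √(δ ^ 4) = δ ^ 2 := by
    rw [show δ ^ 4 = (δ ^ 2) ^ 2 by ring]; exact Real.sqrt_sq (by positivity)
  rw [p34] at hS ⊢
  rw [p12]
  have hkδ : 0 < (k : ℝ) * δ ^ 3 := lt_of_lt_of_le (by positivity) hS
  have hkr : 0 < (k : ℝ) := pos_of_mul_pos_left hkδ (by positivity)
  have hk : 0 < k := by exact_mod_cast hkr
  have hSk : S₀ ≤ k * δ ^ 3 := le_trans (by have : 0 < 2 / ε := by positivity
                                            linarith) hS
  set θ : ℝ := 1 / (k * δ ^ 2) with hθ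
  set m : ℝ := k * δ with hm
  have hθ0 : 0 < θ := by positivity
  have hm0 : 0 < m := by positivity
  have hθS : θ ≤ δ / S₀ := by
    rw [hθ, div_le_div_iff₀ (by positivity) hS₀]; linarith
  have hmS : 1 / m ≤ δ / S₀ := by
    rw [div_le_div_iff₀ hm0 hS₀, hm]
    have : (k : ℝ) * δ ^ 3 ≤ k * δ ^ 2 := by
      gcongr ?_ * ?_
      exact pow_le_pow_of_le_one hδ.le hδ1 (by norm_num)
    linarith
  obtain ⟨b, b₀, hb, ψ, hroot, hb₀, hb₀n, hbb₀, hbre, hbeq, hψ⟩ :=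
    H δ θ m hδ (hδle.trans (min_le_right _ _)) hθ0 hm0 hθS hmS
  obtain ⟨φ, U, W, hφ, hU, hW, hφ0, hU0, hlim, hi, hval⟩ :=
    exists_stream_profile hdef (k := k) hm0 (by rw [hθ, hm]; field_simp)
      (by rw [hθ, hm]; field_simp) hb hbeq hψ
  set lam : ℂ := (m * b) ^ 2 - Complex.I * k with hlam
  have hlamre : lam.re = m ^ 2 * (b ^ 2).re := by
    have : (m * b : ℂ) ^ 2 = ((m ^ 2 : ℝ) : ℂ) * b ^ 2 := by push_cast; ring
    rw [hlam, this, Complex.sub_re, Complex.re_ofReal_mul]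
    simp
  have hre : √|Δ| / 4 * δ ^ 3 * (k : ℝ) ^ 2 ≤ lam.re := by
    rw [hlamre]
    calc _ = m ^ 2 * (δ * (√|Δ| / 4)) := by rw [hm]; ring
      _ ≤ _ := by gcongr
  have hrepos : 0 < lam.re := by
    refine lt_of_lt_of_le ?_ hre
    have := Real.sqrt_pos.2 hΔa
    positivity
  refine ⟨lam, displaysInstability_of_profile hUs hk (θ := θ) (by rw [hsqrt, hθ]; field_simp)
    hlam hrepos hφ hU (fun y hy => by simpa using hW y hy) hφ0 hU0 hlim hi hval, hre,
    (δ * b₀) ^ 2, ?_, reducedDispersion_sq hδ hb₀ hroot, ?_⟩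
  · have : ((δ * b₀ : ℂ) ^ 2).re = δ ^ 3 * b₀.re := by
      -- The equation of b₀ turns α into δ²(δb₀ - 2iΔ), whose real part is δ³ Re b₀.
      have h1 : (δ * b₀ : ℂ) ^ 2 = ((δ ^ 2 : ℝ) : ℂ) * (δ * b₀ - 2 * Complex.I * Δ) := by
        rw [← hroot]; push_cast; ring
      rw [h1, Complex.re_ofReal_mul]
      simp; ring
    rw [this]; positivity
  · have e : lam - (δ * b₀) ^ 2 * (k : ℂ) ^ 2 =
        ((m ^ 2 : ℝ) : ℂ) * ((b - b₀) * ((b - b₀) + 2 * b₀)) - Complex.I * k := by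
      rw [hlam, hm]; push_cast; ring
    rw [e]
    refine (norm_sub_le _ _).trans ?_
    rw [norm_mul, norm_mul, norm_mul Complex.I, Complex.norm_I, one_mul, Complex.norm_real,
      Real.norm_of_nonneg (by positivity), Complex.norm_intCast, abs_of_pos hkr]
    have h1 : ‖b - b₀ + 2 * b₀‖ ≤ 3 + 4 * |Δ| := by
      refine (norm_add_le _ _).trans ?_
      rw [norm_mul, Complex.norm_ofNat]
      have : ε₁ * δ ≤ 1 := mul_le_one₀ (min_le_left _ _) hδ.le hδ1
      linarith
    have h2 : ε₁ * (3 + 4 * |Δ|) ≤ ε / 2 := by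
      calc _ ≤ ε / (2 * (3 + 4 * |Δ|)) * (3 + 4 * |Δ|) := by gcongr; exact min_le_right _ _
        _ = ε / 2 := by field_simp
    have h3 : (k : ℝ) ≤ ε / 2 * δ ^ 3 * k ^ 2 := by
      have : 2 / ε ≤ k * δ ^ 3 := le_trans (by linarith) hS
      rw [div_le_iff₀ hε] at this
      nlinarith
    calc _ ≤ m ^ 2 * (ε₁ * δ * (3 + 4 * |Δ|)) + k := by gcongr
      _ = δ ^ 3 * k ^ 2 * (ε₁ * (3 + 4 * |Δ|)) + k := by rw [hm]; ring
      _ ≤ δ ^ 3 * k ^ 2 * (ε / 2) + ε / 2 * δ ^ 3 * k ^ 2 := by gcongr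
      _ = _ := by ring
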